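/- **Proposition 4.2** ($p,q$ J-fraction for permutations, $\lambda=-1$). *Statistics.* Let $\sigma\in\mathfrak S_n$ be a permutation of $[n]=\{1,\dots,n\}$. An index $i\in[n]$ is a *cycle peak* (cpeak) if $\sigma^{-1}(i)<i>\sigma(i)$, a *cycle valley* (cval) if $\sigma^{-1}(i)>i<\sigma(i)$, a *cycle double rise* (cdrise) if $\sigma^{-1}(i)<i<\sigma(i)$, a *cycle double fall* (cdfall) if $\sigma^{-1}(i)>i>\sigma(i)$, and a *fixed point* if $\sigma(i)=i$; $\mathrm{Fix}(\sigma)$ is the set of fixed points. The index $i$ is a *record* if $\sigma(j)<\sigma(i)$ for all $j<i$, and an *antirecord* if $\sigma(j)>\sigma(i)$ for all $j>i$; it is an *exclusive record* (resp. *exclusive antirecord*) if it is a record (resp. antirecord) but not also an antirecord (resp. record). Let $\mathrm{eareccpeak}(\sigma)$, $\mathrm{eareccdfall}(\sigma)$ be the numbers of exclusive antirecords that are cycle peaks, cycle double falls; $\mathrm{ereccval}(\sigma)$, $\mathrm{ereccdrise}(\sigma)$ the numbers of exclusive records that are cycle valleys, cycle double rises; and $\mathrm{nrcpeak}(\sigma)$,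 $\mathrm{nrcdfall}(\sigma)$, $\mathrm{nrcval}(\sigma)$, $\mathrm{nrcdrise}(\sigma)$ the numbers of indices of the indicated cycle type that are neither records nor antirecords. A quadruplet $i<j<k<l$ in $[n]$ is an *upper crossing* if $k=\sigma(i)$, $l=\sigma(j)$; a *lower crossing* if $i=\sigma(k)$, $j=\sigma(l)$; an *upper nesting* if $l=\sigma(i)$, $k=\sigma(j)$; a *lower nesting* if $i=\sigma(l)$, $j=\sigma(k)$. Let $\mathrm{ucrosscval}(\sigma)$, $\mathrm{unestcval}(\sigma)$ (resp. $\mathrm{ucrosscdrise}(\sigma)$, $\mathrm{unestcdrise}(\sigma)$) be the numbers of upper crossings and upper nestings for which $\sigma^{-1}(j)>j$ (resp. $\sigma^{-1}(j)<j$), and let $\mathrm{lcrosscpeak}(\sigma)$, $\mathrm{lnestcpeak}(\sigma)$ (resp. $\mathrm{lcrosscdfall}(\sigma)$, $\mathrm{lnestcdfall}(\sigma)$) be the numbers of lower crossings and lower nestings for which $\sigma^{-1}(k)<k$ (resp. $\sigma^{-1}(k)>k$). Let $\mathrm{psnest}(\sigma)$ be the number of triplets $i<j<l$ with $l=\sigma(i)$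 and $j=\sigma(j)$; for a fixed point $j$ let $\mathrm{psnest}(j,\sigma)=\#\{i<j:\sigma(i)>j\}$. Let $\mathrm{cyc}(\sigma)$ be the number of cycles of $\sigma$, fixed points included. *Polynomials.* For indeterminates $x_1,x_2,y_1,y_2,u_1,u_2,v_1,v_2$, $\mathbf w=(w_\ell)_{\ell\ge0}$, $p_{\pm1},p_{\pm2},q_{\pm1},q_{\pm2}$, $s$, $\lambda$ and $n\ge0$ define $$ \begin{aligned} P_n(\lambda)=\sum_{\sigma\in\mathfrak S_n} & x_1^{\mathrm{eareccpeak}(\sigma)}x_2^{\mathrm{eareccdfall}(\sigma)}y_1^{\mathrm{ereccval}(\sigma)}y_2^{\mathrm{ereccdrise}(\sigma)} \,u_1^{\mathrm{nrcpeak}(\sigma)}u_2^{\mathrm{nrcdfall}(\sigma)}v_1^{\mathrm{nrcval}(\sigma)}v_2^{\mathrm{nrcdrise}(\sigma)} \prod_{i\in\mathrm{Fix}(\sigma)}w_{\mathrm{psnest}(i,\sigma)}\\ &\times p_{+1}^{\mathrm{ucrosscval}(\sigma)}p_{+2}^{\mathrm{ucrosscdrise}(\sigma)}p_{-1}^{\mathrm{lcrosscpeak}(\sigma)}p_{-2}^{\mathrm{lcrosscdfall}(\sigma)}\\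 &\times q_{+1}^{\mathrm{unestcval}(\sigma)}q_{+2}^{\mathrm{unestcdrise}(\sigma)}q_{-1}^{\mathrm{lnestcpeak}(\sigma)}q_{-2}^{\mathrm{lnestcdfall}(\sigma)} \,s^{\mathrm{psnest}(\sigma)}\,\lambda^{\mathrm{cyc}(\sigma)}, \end{aligned} $$ and write $[n]_{p,q}=\sum_{j=0}^{n-1}p^jq^{n-1-j}$. *Claim.* As formal power series in $t$, $$ \sum_{n=0}^\infty P_n(-1)\,t^n=\cfrac{1}{1-\gamma_0t-\cfrac{\beta_1t^2}{1-\gamma_1t-\cfrac{\beta_2t^2}{1-\cdots}}} $$ (the right-hand side being the coefficientwise limit of its finite truncations), with $\gamma_0=-w_0$ and, for $n\ge1$, $$ \gamma_n=\bigl((-p_{-2})^{n-1}x_2+q_{-2}[n-1]_{-p_{-2},q_{-2}}u_2\bigr)+\bigl((-p_{+2})^{n-1}y_2+q_{+2}[n-1]_{-p_{+2},q_{+2}}v_2\bigr)-s^nw_n, $$ $$ \beta_n=-\bigl((-p_{-1})^{n-1}x_1+q_{-1}[n-1]_{-p_{-1},q_{-1}}u_1\bigr)\bigl((-p_{+1})^{n-1}y_1+q_{+1}[n-1]_{-p_{+1},q_{+1}}v_1\bigr).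 $$ The identity holds more generally for arbitrary values of the variables in any commutative ring. -/

import Mathlib

/-! Permutation statistics and J-type continued fractions.

Permutations of `[n]` are `Equiv.Perm (Fin n)`; only the order of the indices matters, so
numbering them from `0` instead of `1` changes nothing. -/

namespace PermJ

section Statistics

variable {n : ℕ}

/-! ### Cycle classification -/

/-- `i` is a cycle peak: `σ⁻¹(i) < i > σ(i)`. -/
abbrev IsCpeak (σ : Equiv.Perm (Fin n)) (i : Fin n) : Prop := σ⁻¹ i < i ∧ σ i < i

/-- `i` is a cycle valley: `σ⁻¹(i) > i < σ(i)`. -/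
abbrev IsCval (σ : Equiv.Perm (Fin n)) (i : Fin n) : Prop := i < σ⁻¹ i ∧ i < σ i

/-- `i` is a cycle double rise: `σ⁻¹(i) < i < σ(i)`. -/
abbrev IsCdrise (σ : Equiv.Perm (Fin n)) (i : Fin n) : Prop := σ⁻¹ i < i ∧ i < σ i

/-- `i` is a cycle double fall: `σ⁻¹(i) > i > σ(i)`. -/
abbrev IsCdfall (σ : Equiv.Perm (Fin n)) (i : Fin n) : Prop := i < σ⁻¹ i ∧ σ i < i

/-- The set `Fix(σ)` of fixed points. -/
def fixSet (σ : Equiv.Perm (Fin n)) : Finset (Fin n) := {i | σ i = i}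

/-- The number of cycles of `σ`, fixed points included
(`Equiv.Perm.cycleType` lists the lengths of the cycles of length at least two). -/
def cyc (σ : Equiv.Perm (Fin n)) : ℕ := Multiset.card σ.cycleType + (fixSet σ).card

/-! ### Record classification -/

/-- `i` is a record (left-to-right maximum). -/
abbrev IsRec (σ : Equiv.Perm (Fin n)) (i : Fin n) : Prop := ∀ j, j < i → σ j < σ i

/-- `i` is an antirecord (right-to-left minimum). -/
abbrev IsArec (σ : Equiv.Perm (Fin n)) (i : Fin n) : Prop := ∀ j, i < j → σ i < σ j

/-- `i` is an exclusive record: a record that is not an antirecord. -/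
abbrev IsErec (σ : Equiv.Perm (Fin n)) (i : Fin n) : Prop := IsRec σ i ∧ ¬ IsArec σ i

/-- `i` is an exclusive antirecord: an antirecord that is not a record. -/
abbrev IsEarec (σ : Equiv.Perm (Fin n)) (i : Fin n) : Prop := IsArec σ i ∧ ¬ IsRec σ i

/-- `i` is neither a record nor an antirecord. -/
abbrev IsNrar (σ : Equiv.Perm (Fin n)) (i : Fin n) : Prop := ¬ IsRec σ i ∧ ¬ IsArec σ i

/-! ### Record-and-cycle classification -/

/-- Number of exclusive antirecords that are cycle peaks. -/
def eareccpeak (σ : Equiv.Perm (Fin n)) : ℕ :=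
  Finset.card {i : Fin n | IsEarec σ i ∧ IsCpeak σ i}

/-- Number of exclusive antirecords that are cycle double falls. -/
def eareccdfall (σ : Equiv.Perm (Fin n)) : ℕ :=
  Finset.card {i : Fin n | IsEarec σ i ∧ IsCdfall σ i}

/-- Number of exclusive records that are cycle valleys. -/
def ereccval (σ : Equiv.Perm (Fin n)) : ℕ :=
  Finset.card {i : Fin n | IsErec σ i ∧ IsCval σ i}

/-- Number of exclusive records that are cycle double rises. -/
def ereccdrise (σ : Equiv.Perm (Fin n)) : ℕ :=
  Finset.card {i : Fin n | IsErec σ i ∧ IsCdrise σ i}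

/-- Number of neither-record-antirecords that are cycle peaks. -/
def nrcpeak (σ : Equiv.Perm (Fin n)) : ℕ :=
  Finset.card {i : Fin n | IsNrar σ i ∧ IsCpeak σ i}

/-- Number of neither-record-antirecords that are cycle double falls. -/
def nrcdfall (σ : Equiv.Perm (Fin n)) : ℕ :=
  Finset.card {i : Fin n | IsNrar σ i ∧ IsCdfall σ i}

/-- Number of neither-record-antirecords that are cycle valleys. -/
def nrcval (σ : Equiv.Perm (Fin n)) : ℕ :=
  Finset.card {i : Fin n | IsNrar σ i ∧ IsCval σ i}

/-- Number of neither-record-antirecords that are cycle double rises. -/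
def nrcdrise (σ : Equiv.Perm (Fin n)) : ℕ :=
  Finset.card {i : Fin n | IsNrar σ i ∧ IsCdrise σ i}

/-! ### Crossings and nestings -/

/-- The quadruplet `i < j < k < l` forms an upper crossing. -/
abbrev IsUcross (σ : Equiv.Perm (Fin n)) (i j k l : Fin n) : Prop :=
  i < j ∧ j < k ∧ k < l ∧ k = σ i ∧ l = σ j

/-- The quadruplet `i < j < k < l` forms a lower crossing. -/
abbrev IsLcross (σ : Equiv.Perm (Fin n)) (i j k l : Fin n) : Prop :=
  i < j ∧ j < k ∧ k < l ∧ i = σ k ∧ j = σ l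

/-- The quadruplet `i < j < k < l` forms an upper nesting. -/
abbrev IsUnest (σ : Equiv.Perm (Fin n)) (i j k l : Fin n) : Prop :=
  i < j ∧ j < k ∧ k < l ∧ l = σ i ∧ k = σ j

/-- The quadruplet `i < j < k < l` forms a lower nesting. -/
abbrev IsLnest (σ : Equiv.Perm (Fin n)) (i j k l : Fin n) : Prop :=
  i < j ∧ j < k ∧ k < l ∧ i = σ l ∧ j = σ k

/-- Number of upper crossings of type cval. -/
def ucrosscval (σ : Equiv.Perm (Fin n)) : ℕ :=
  Finset.card {(i, j, k, l) : Fin n × Fin n × Fin n × Fin n | IsUcross σ i j k l ∧ j < σ⁻¹ j}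

/-- Number of upper crossings of type cdrise. -/
def ucrosscdrise (σ : Equiv.Perm (Fin n)) : ℕ :=
  Finset.card {(i, j, k, l) : Fin n × Fin n × Fin n × Fin n | IsUcross σ i j k l ∧ σ⁻¹ j < j}

/-- Number of lower crossings of type cpeak. -/
def lcrosscpeak (σ : Equiv.Perm (Fin n)) : ℕ :=
  Finset.card {(i, j, k, l) : Fin n × Fin n × Fin n × Fin n | IsLcross σ i j k l ∧ σ⁻¹ k < k}

/-- Number of lower crossings of type cdfall. -/
def lcrosscdfall (σ : Equiv.Perm (Fin n)) : ℕ :=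
  Finset.card {(i, j, k, l) : Fin n × Fin n × Fin n × Fin n | IsLcross σ i j k l ∧ k < σ⁻¹ k}

/-- Number of upper nestings of type cval. -/
def unestcval (σ : Equiv.Perm (Fin n)) : ℕ :=
  Finset.card {(i, j, k, l) : Fin n × Fin n × Fin n × Fin n | IsUnest σ i j k l ∧ j < σ⁻¹ j}

/-- Number of upper nestings of type cdrise. -/
def unestcdrise (σ : Equiv.Perm (Fin n)) : ℕ :=
  Finset.card {(i, j, k, l) : Fin n × Fin n × Fin n × Fin n | IsUnest σ i j k l ∧ σ⁻¹ j < j}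

/-- Number of lower nestings of type cpeak. -/
def lnestcpeak (σ : Equiv.Perm (Fin n)) : ℕ :=
  Finset.card {(i, j, k, l) : Fin n × Fin n × Fin n × Fin n | IsLnest σ i j k l ∧ σ⁻¹ k < k}

/-- Number of lower nestings of type cdfall. -/
def lnestcdfall (σ : Equiv.Perm (Fin n)) : ℕ :=
  Finset.card {(i, j, k, l) : Fin n × Fin n × Fin n × Fin n | IsLnest σ i j k l ∧ k < σ⁻¹ k}

/-- The number of pseudo-nestings: triplets `i < j < l` with `l = σ(i)` and `j = σ(j)`
(the number of those with `i = σ(l)` and `j = σ(j)` is the same). -/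
def psnest (σ : Equiv.Perm (Fin n)) : ℕ :=
  Finset.card {(i, j, l) : Fin n × Fin n × Fin n | i < j ∧ j < l ∧ l = σ i ∧ j = σ j}

/-- The level `psnest(j, σ) = #{i < j : σ(i) > j}` of a fixed point `j`. -/
def psnestAt (σ : Equiv.Perm (Fin n)) (j : Fin n) : ℕ :=
  Finset.card {i : Fin n | i < j ∧ j < σ i}

end Statistics

section Algebra

variable {R : Type*} [CommRing R]

/-- The polynomial `P_n(x₁,x₂,y₁,y₂,u₁,u₂,v₁,v₂,w,p₊₁,p₊₂,p₋₁,p₋₂,q₊₁,q₊₂,q₋₁,q₋₂,s,λ)`,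
with values of its variables taken in an arbitrary commutative ring `R`
(for `R` a polynomial ring over `ℤ` and its indeterminates, this is the polynomial itself).
The factor for the fixed points is the product of `w_ℓ` over fixed points,
`ℓ` being the level of the fixed point. -/
def P (n : ℕ) (x₁ x₂ y₁ y₂ u₁ u₂ v₁ v₂ : R) (w : ℕ → R)
    (pp1 pp2 pm1 pm2 qp1 qp2 qm1 qm2 s lam : R) : R :=
  ∑ σ : Equiv.Perm (Fin n),
    x₁ ^ eareccpeak σ * x₂ ^ eareccdfall σ * y₁ ^ ereccval σ * y₂ ^ ereccdrise σ
    * (u₁ ^ nrcpeak σ * u₂ ^ nrcdfall σ * v₁ ^ nrcval σ * v₂ ^ nrcdrise σ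
      * ∏ i ∈ fixSet σ, w (psnestAt σ i))
    * (pp1 ^ ucrosscval σ * pp2 ^ ucrosscdrise σ * pm1 ^ lcrosscpeak σ * pm2 ^ lcrosscdfall σ)
    * (qp1 ^ unestcval σ * qp2 ^ unestcdrise σ * qm1 ^ lnestcpeak σ * qm2 ^ lnestcdfall σ)
    * s ^ psnest σ * lam ^ cyc σ

/-- `[n]_{p,q} = ∑_{j=0}^{n-1} p^j q^{n-1-j}`. -/
def pqInt (p q : R) (n : ℕ) : R := ∑ j ∈ Finset.range n, p ^ j * q ^ (n - 1 - j)

/-- The finite continued fraction with `N` levels that starts at index `k`,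
`1/(1 - γ_k t - β_{k+1} t²/(1 - γ_{k+1} t - β_{k+2} t²/( ⋯ /(1 - γ_{k+N-1} t))))`,
as a formal power series in `t` (and `0` when `N = 0`). Every denominator has constant term `1`,
hence is invertible. -/
noncomputable def jConvergent (γ β : ℕ → R) : ℕ → ℕ → PowerSeries R
  | 0, _ => 0
  | N + 1, k =>
    PowerSeries.invOfUnit
      (1 - PowerSeries.C (γ k) * PowerSeries.X
        - PowerSeries.C (β (k + 1)) * PowerSeries.X ^ 2 * jConvergent γ β N (k + 1)) 1

/-- The formal power series `F` equals the infinite J-type continued fraction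
`1/(1 - γ₀ t - β₁ t²/(1 - γ₁ t - β₂ t²/(1 - ⋯)))`: `F` is the limit of the finite truncations of
the continued fraction, i.e. each coefficient of the truncations is eventually that of `F`. -/
def HasJFraction (F : PowerSeries R) (γ β : ℕ → R) : Prop :=
  ∀ m : ℕ, ∀ᶠ N in Filter.atTop,
    PowerSeries.coeff m (jConvergent γ β N 0) = PowerSeries.coeff m F

end Algebra

end PermJ

/-! Draw `i → σ i` as an upper arc when `i < σ i` and as a lower arc when `σ i < i`. Scanning from
left to right, a cycle valley opens one arc of each kind, a cycle peak closes one of each, and a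
double rise or double fall closes one arc and opens another of the same kind. The word of types is
thus a Motzkin path whose height counts the open upper arcs and equally the open lower arcs. In a
word, `none` is a fixed point, `(true, false)` a valley, `(true, true)` a double rise, `(false,
true)` a peak and `(false, false)` a double fall.

For a fixed word, a permutation is an independent choice of upper and lower arcs. At each arc the
rank of the chosen partner among `N` candidates gives `r` crossings and `N - 1 - r` nestings, and
`N` depends only on the height and the type. The sum over a fibre therefore factors into step
weights (`sum_placements`, `sum_fiber`). Summing over words gives weighted Motzkin paths
(`sum_words`), hence a J-fraction (`hasJFraction_motzkin`).

It remains to make the summand local. Record status is the vanishing of a nesting number. For the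
sign, `(-1)^cyc` is `(-1)^n` times the sign of the permutation, and modulo 2 the inversion number
splits into contributions of single indices (`sum_downNest_eq`). The outcome is that `cyc` has the
parity of fixed points plus cycle peaks plus crossings. So every crossing variable changes sign,
every `w` changes sign, and each peak brings the minus sign of `β`. -/

namespace PermJ

/-! ### Motzkin paths and J-fractions. -/

section Motzkin

variable {R : Type*} [CommRing R]

/-- The weighted count of Motzkin paths with `m` steps from height `h` to height `0`, a rise from
height `i` having weight `a i`, a level step `γ i`, and a fall from height `i` weight `b i`. -/
def motzkin (a γ b : ℕ → R) : ℕ → ℕ → R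
  | 0, h => if h = 0 then 1 else 0
  | m + 1, 0 => a 0 * motzkin a γ b m 1 + γ 0 * motzkin a γ b m 0
  | m + 1, h + 1 => a (h + 1) * motzkin a γ b m (h + 2) + γ (h + 1) * motzkin a γ b m (h + 1)
      + b (h + 1) * motzkin a γ b m h

lemma jConvergent_succ_mul (γ β : ℕ → R) (N k : ℕ) :
    jConvergent γ β (N + 1) k * (1 - PowerSeries.C (γ k) * PowerSeries.X
      - PowerSeries.C (β (k + 1)) * PowerSeries.X ^ 2 * jConvergent γ β N (k + 1)) = 1 := by
  rw [jConvergent, mul_comm]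
  exact PowerSeries.mul_invOfUnit _ _ (by simp)

/-- The generating function of paths from height `h` that stay below height `N`. -/
noncomputable def pathSeries (γ β b : ℕ → R) (N : ℕ) : ℕ → PowerSeries R
  | 0 => jConvergent γ β N 0
  -- Cut at the first descent to `h`: before it the path stays at heights from `h + 1` to `N - 1`,
  -- which the truncation started at `h + 1` counts.
  | h + 1 => PowerSeries.C (b (h + 1)) * PowerSeries.X * jConvergent γ β (N - (h + 1)) (h + 1)
      * pathSeries γ β b N h

lemma pathSeries_zero_eq (a γ b β : ℕ → R) (hβ : ∀ h, β (h + 1) = a h * b (h + 1)) (N : ℕ)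
    (hN : 0 < N) :
    pathSeries γ β b N 0 = 1 + PowerSeries.X * (PowerSeries.C (a 0) * pathSeries γ β b N 1
      + PowerSeries.C (γ 0) * pathSeries γ β b N 0) := by
  obtain ⟨M, rfl⟩ : ∃ M, N = M + 1 := ⟨N - 1, by omega⟩
  have h := jConvergent_succ_mul γ β M 0
  simp only [pathSeries, zero_add, Nat.add_sub_cancel, hβ 0, map_mul] at h ⊢
  linear_combination h

lemma pathSeries_succ_eq (a γ b β : ℕ → R) (hβ : ∀ h, β (h + 1) = a h * b (h + 1)) (N h : ℕ)
    (hN : h + 1 < N) :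
    pathSeries γ β b N (h + 1) = PowerSeries.X * (PowerSeries.C (a (h + 1)) *
      pathSeries γ β b N (h + 2) + PowerSeries.C (γ (h + 1)) * pathSeries γ β b N (h + 1)
      + PowerSeries.C (b (h + 1)) * pathSeries γ β b N h) := by
  obtain ⟨M, rfl⟩ : ∃ M, N = M + 1 + (h + 1) := ⟨N - (h + 2), by omega⟩
  have e : M + 1 + (h + 1) - (h + 1 + 1) = M := by omega
  have H := jConvergent_succ_mul γ β M (h + 1)
  simp only [pathSeries, Nat.add_sub_cancel, e, hβ (h + 1), map_mul] at H ⊢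
  linear_combination (PowerSeries.C (b (h + 1)) * PowerSeries.X *
    pathSeries γ β b (M + 1 + (h + 1)) h) * H

/-- In `m` steps from `h` a path cannot reach height `N`, so the ceiling is not felt; both sides
then obey the same first-step recursion. -/
lemma coeff_pathSeries (a γ b β : ℕ → R) (hβ : ∀ h, β (h + 1) = a h * b (h + 1)) (N m h : ℕ)
    (hN : m + h < N) :
    PowerSeries.coeff m (pathSeries γ β b N h) = motzkin a γ b m h := by
  induction m generalizing h with
  | zero =>
    cases h with
    | zero => rw [pathSeries_zero_eq a γ b β hβ N (by omega)]; simp [motzkin]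
    | succ h => rw [pathSeries_succ_eq a γ b β hβ N h (by omega)]; simp [motzkin]
  | succ m ih =>
    cases h with
    | zero =>
      rw [pathSeries_zero_eq a γ b β hβ N (by omega)]
      simp [motzkin, PowerSeries.coeff_succ_X_mul, PowerSeries.coeff_one, ih 0 (by omega),
        ih 1 (by omega)]
    | succ h =>
      rw [pathSeries_succ_eq a γ b β hβ N h (by omega)]
      simp [motzkin, PowerSeries.coeff_succ_X_mul, ih h (by omega), ih (h + 1) (by omega),
        ih (h + 2) (by omega)]

theorem hasJFraction_motzkin (a γ b β : ℕ → R) (hβ : ∀ h, β (h + 1) = a h * b (h + 1)) :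
    HasJFraction (PowerSeries.mk fun n => motzkin a γ b n 0) γ β := by
  intro m
  filter_upwards [Filter.eventually_gt_atTop m] with N hN
  rw [PowerSeries.coeff_mk, ← coeff_pathSeries a γ b β hβ N m 0 (by omega), pathSeries]

end Motzkin

end PermJ

namespace PermJ

/-! ### Upper arcs with prescribed starts and ends. -/

section Placements

open Finset

variable {R : Type*} [CommRing R] {α : Type*} [LinearOrder α]

/-- In a finite chain, an element is determined by the number of elements below it. -/
lemma sum_card_lt_card_gt (S : Finset α) (F : ℕ → ℕ → R) :
    ∑ b ∈ S, F #{v ∈ S | v < b} #{v ∈ S | b < v} = ∑ r ∈ range #S, F r (#S - 1 - r) := by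
  induction S using Finset.induction_on_max generalizing F with
  | empty => simp
  | insert m S hm ih =>
    have hmS : m ∉ S := fun h => lt_irrefl _ (hm m h)
    rw [sum_insert hmS, card_insert_of_notMem hmS, sum_range_succ, add_comm]
    congr 1
    · have h1 := ih fun r s => F r (s + 1)
      have h2 : ∀ r ∈ range #S, F r (#S + 1 - 1 - r) = F r (#S - 1 - r + 1) := by
        intro r hr
        have := mem_range.1 hr
        congr 1; omega
      rw [sum_congr rfl h2, ← h1]
      refine sum_congr rfl fun b hb => ?_
      have hb' := hm b hb
      rw [filter_insert, if_neg (not_lt.2 hb'.le), filter_insert, if_pos hb',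
        card_insert_of_notMem (by simp [hmS])]
    · have e1 : {v ∈ insert m S | v < m} = S := by
        ext v; simp only [mem_filter, mem_insert]
        constructor
        · rintro ⟨rfl | h, h'⟩
          · exact absurd h' (lt_irrefl _)
          · exact h
        · exact fun h => ⟨Or.inr h, hm v h⟩
      have e2 : {v ∈ insert m S | m < v} = ∅ := by
        ext v; simp only [mem_filter, mem_insert, notMem_empty, iff_false]
        rintro ⟨rfl | h, h'⟩
        · exact lt_irrefl _ h'
        · exact lt_asymm h' (hm v h)
      rw [e1, e2]; simp

variable [Fintype α]

/-- The functions that restrict to a bijection from `A` onto `B` moving every point up, extended by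
the identity. -/
def placements (A B : Finset α) : Finset (α → α) :=
  {f | (∀ i, i ∉ A → f i = i) ∧ (∀ i ∈ A, i < f i) ∧ Set.InjOn f A ∧ A.image f = B}

lemma mem_placements {A B : Finset α} {f : α → α} : f ∈ placements A B ↔
    (∀ i, i ∉ A → f i = i) ∧ (∀ i ∈ A, i < f i) ∧ Set.InjOn f A ∧ A.image f = B := by
  simp [placements]

/-- The number of arcs of `f` that start before `a` and end between `a` and `f a`. -/
def crossAt (A : Finset α) (f : α → α) (a : α) : ℕ := #{i ∈ A | i < a ∧ a < f i ∧ f i < f a}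

/-- The number of arcs of `f` that start before `a` and end after `f a`. -/
def nestAt (A : Finset α) (f : α → α) (a : α) : ℕ := #{i ∈ A | i < a ∧ f a < f i}

lemma update_mem_placements {S B : Finset α} {a b : α} (ha : ∀ x ∈ S, x < a) (hb : b ∈ B)
    (hab : a < b) {g : α → α} (hg : g ∈ placements S (B.erase b)) :
    Function.update g a b ∈ placements (insert a S) B := by
  have haS : a ∉ S := fun h => lt_irrefl _ (ha a h)
  obtain ⟨h1, h2, h3, h4⟩ := mem_placements.1 hg
  have hne : ∀ i ∈ S, i ≠ a := fun i hi => (ha i hi).ne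
  have hgb : ∀ i ∈ S, g i ≠ b := fun i hi h => by
    have : g i ∈ B.erase b := h4 ▸ mem_image_of_mem g hi
    exact (mem_erase.1 this).1 h
  have him : S.image (Function.update g a b) = B.erase b := by
    rw [← h4]; exact image_congr fun i hi => Function.update_of_ne (hne i hi) _ _
  refine mem_placements.2 ⟨fun i hi => ?_, fun i hi => ?_, ?_, ?_⟩
  · rw [mem_insert, not_or] at hi
    rw [Function.update_of_ne hi.1, h1 i hi.2]
  · rcases mem_insert.1 hi with rfl | hi
    · simpa
    · rw [Function.update_of_ne (hne i hi)]; exact h2 i hi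
  · intro i hi j hj hij
    rcases mem_insert.1 (mem_coe.1 hi) with hi' | hi' <;>
      rcases mem_insert.1 (mem_coe.1 hj) with hj' | hj'
    · rw [hi', hj']
    · rw [hi', Function.update_self, Function.update_of_ne (hne j hj')] at hij
      exact absurd hij.symm (hgb j hj')
    · rw [hj', Function.update_self, Function.update_of_ne (hne i hi')] at hij
      exact absurd hij (hgb i hi')
    · rw [Function.update_of_ne (hne i hi'), Function.update_of_ne (hne j hj')] at hij
      exact h3 hi' hj' hij
  · rw [image_insert, him, Function.update_self, insert_erase hb]

lemma restrict_mem_placements {S B : Finset α} {a : α} (ha : ∀ x ∈ S, x < a) {f : α → α}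
    (hf : f ∈ placements (insert a S) B) :
    f a ∈ B ∧ a < f a ∧ Function.update f a a ∈ placements S (B.erase (f a)) := by
  have haS : a ∉ S := fun h => lt_irrefl _ (ha a h)
  obtain ⟨h1, h2, h3, h4⟩ := mem_placements.1 hf
  have hne : ∀ i ∈ S, i ≠ a := fun i hi => (ha i hi).ne
  have him : S.image (Function.update f a a) = S.image f :=
    image_congr fun i hi => Function.update_of_ne (hne i hi) _ _
  have hfa : f a ∉ S.image f := by
    rw [mem_image]; rintro ⟨i, hi, hia⟩
    exact hne i hi (h3 (by simp [hi]) (by simp) hia)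
  refine ⟨h4 ▸ mem_image_of_mem f (mem_insert_self a S), h2 a (mem_insert_self a S),
    mem_placements.2 ⟨fun i hi => ?_, fun i hi => ?_, ?_, ?_⟩⟩
  · by_cases hia : i = a
    · subst hia; simp
    · rw [Function.update_of_ne hia, h1 i (by simp [hi, hia])]
  · rw [Function.update_of_ne (hne i hi)]; exact h2 i (mem_insert_of_mem hi)
  · intro i hi j hj hij
    rw [Function.update_of_ne (hne i hi), Function.update_of_ne (hne j hj)] at hij
    exact h3 (by simp [mem_coe.1 hi]) (by simp [mem_coe.1 hj]) hij
  · rw [him, ← h4, image_insert, erase_insert hfa]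

omit [Fintype α] in
-- Only arcs starting before `i` are counted at `i`, so an arc added at the maximum is invisible
-- there. This is why the largest start is peeled off.
lemma crossAt_insert_max {S : Finset α} {a b : α} (ha : ∀ x ∈ S, x < a) (g : α → α) {i : α}
    (hi : i ∈ S) :
    crossAt (insert a S) (Function.update g a b) i = crossAt S g i := by
  have hne : ∀ i ∈ S, i ≠ a := fun i hi => (ha i hi).ne
  unfold crossAt
  congr 1
  rw [filter_insert, if_neg fun h => lt_asymm h.1 (ha i hi)]
  refine filter_congr fun j hj => ?_
  rw [Function.update_of_ne (hne i hi), Function.update_of_ne (hne j hj)]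

omit [Fintype α] in
lemma nestAt_insert_max {S : Finset α} {a b : α} (ha : ∀ x ∈ S, x < a) (g : α → α) {i : α}
    (hi : i ∈ S) :
    nestAt (insert a S) (Function.update g a b) i = nestAt S g i := by
  have hne : ∀ i ∈ S, i ≠ a := fun i hi => (ha i hi).ne
  unfold nestAt
  congr 1
  rw [filter_insert, if_neg fun h => lt_asymm h.1 (ha i hi)]
  refine filter_congr fun j hj => ?_
  rw [Function.update_of_ne (hne i hi), Function.update_of_ne (hne j hj)]

/-- Every other value above `a` ends an arc that starts below `a`, so the crossings at `a` are given
by the rank of `b` among the values above `a`. The nestings are its corank. -/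
lemma crossAt_max {S B : Finset α} {a b : α} (ha : ∀ x ∈ S, x < a)
    {g : α → α} (hg : g ∈ placements S (B.erase b)) :
    crossAt (insert a S) (Function.update g a b) a = #{v ∈ {v ∈ B | a < v} | v < b} := by
  obtain ⟨h1, h2, h3, h4⟩ := mem_placements.1 hg
  have hne : ∀ i ∈ S, i ≠ a := fun i hi => (ha i hi).ne
  have e : {v ∈ {v ∈ B | a < v} | v < b} = ({i ∈ S | a < g i ∧ g i < b}).image g := by
    rw [← filter_image (s := S) (f := g) (p := fun v => a < v ∧ v < b), h4]
    ext v
    simp only [mem_filter, mem_erase]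
    constructor
    · rintro ⟨⟨h, h'⟩, h''⟩; exact ⟨⟨h''.ne, h⟩, h', h''⟩
    · rintro ⟨⟨-, h⟩, h', h''⟩; exact ⟨⟨h, h'⟩, h''⟩
  rw [e, card_image_of_injOn (h3.mono (coe_subset.2 (filter_subset _ _)))]
  unfold crossAt
  congr 1
  rw [filter_insert, if_neg fun h => lt_irrefl _ h.1]
  refine filter_congr fun j hj => ?_
  rw [Function.update_self, Function.update_of_ne (hne j hj)]
  simp [ha j hj]

lemma nestAt_max {S B : Finset α} {a b : α} (ha : ∀ x ∈ S, x < a) (hab : a < b)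
    {g : α → α} (hg : g ∈ placements S (B.erase b)) :
    nestAt (insert a S) (Function.update g a b) a = #{v ∈ {v ∈ B | a < v} | b < v} := by
  obtain ⟨h1, h2, h3, h4⟩ := mem_placements.1 hg
  have hne : ∀ i ∈ S, i ≠ a := fun i hi => (ha i hi).ne
  have e : {v ∈ {v ∈ B | a < v} | b < v} = ({i ∈ S | b < g i}).image g := by
    rw [← filter_image (s := S) (f := g) (p := fun v => b < v), h4]
    ext v
    simp only [mem_filter, mem_erase]
    constructor
    · rintro ⟨⟨h, h'⟩, h''⟩; exact ⟨⟨h''.ne', h⟩, h''⟩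
    · rintro ⟨⟨-, h⟩, h'⟩; exact ⟨⟨h, hab.trans h'⟩, h'⟩
  rw [e, card_image_of_injOn (h3.mono (coe_subset.2 (filter_subset _ _)))]
  unfold nestAt
  congr 1
  rw [filter_insert, if_neg fun h => lt_irrefl _ h.1]
  refine filter_congr fun j hj => ?_
  rw [Function.update_self, Function.update_of_ne (hne j hj)]
  simp [ha j hj]

/-- Splitting a sum over placements by the image of the largest point. -/
lemma sum_placements_insert_max {S B : Finset α} {a : α} (ha : ∀ x ∈ S, x < a)
    (Φ : (α → α) → R) :
    ∑ f ∈ placements (insert a S) B, Φ f =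
      ∑ b ∈ B with a < b, ∑ g ∈ placements S (B.erase b), Φ (Function.update g a b) := by
  have haS : a ∉ S := fun h => lt_irrefl _ (ha a h)
  rw [sum_sigma']
  refine sum_bij' (fun f _ => ⟨f a, Function.update f a a⟩)
    (fun p _ => Function.update p.2 a p.1) ?_ ?_ ?_ ?_ ?_
  · intro f hf
    obtain ⟨h1, h2, h3⟩ := restrict_mem_placements ha hf
    simp [h1, h2, h3]
  · rintro ⟨b, g⟩ hp
    simp only [mem_sigma, mem_filter] at hp
    exact update_mem_placements ha hp.1.1 hp.1.2 hp.2
  · intro f hf; simp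
  · rintro ⟨b, g⟩ hp
    simp only [mem_sigma, mem_filter] at hp
    have := (mem_placements.1 hp.2).1 a haS
    simp only [Function.update_self, Function.update_idem, Sigma.mk.injEq, heq_eq_eq, true_and]
    exact Function.update_eq_self_iff.2 this.symm
  · intro f hf; simp

/-- Choose images in decreasing order of the starts. At `a` the free values above `a` number the
difference in the formula, whatever was chosen before, and the rank of the choice gives the
crossings and nestings. If values run short, the truncated difference is zero and the product
vanishes, as it should. -/
theorem sum_placements (c : α → ℕ → ℕ → R) (A B : Finset α) :
    ∑ f ∈ placements A B, ∏ a ∈ A, c a (crossAt A f a) (nestAt A f a) =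
      if #A = #B then ∏ a ∈ A, ∑ r ∈ range (#{v ∈ B | a < v} - #{v ∈ A | a < v}),
        c a r (#{v ∈ B | a < v} - #{v ∈ A | a < v} - 1 - r) else 0 := by
  induction A using Finset.induction_on_max generalizing B with
  | empty =>
    by_cases hB : B = ∅
    · subst hB
      have : placements (∅ : Finset α) ∅ = {id} := by
        ext f; simp [mem_placements, funext_iff]
      simp [this]
    · have : placements (∅ : Finset α) B = ∅ := by
        ext f; simp [mem_placements, Ne.symm hB]
      have h2 : #B ≠ 0 := by simpa using hB
      simp [this, h2.symm]
  | insert a S ha ih =>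
    have haS : a ∉ S := fun h => lt_irrefl _ (ha a h)
    rw [sum_placements_insert_max ha]
    set K : α → ℕ := fun i => #{v ∈ B | i < v} - #{v ∈ insert a S | i < v} with hK
    have hKa : K a = #{v ∈ B | a < v} := by
      have : {v ∈ insert a S | a < v} = ∅ := by
        ext v; simp only [mem_filter, mem_insert, notMem_empty, iff_false]
        rintro ⟨rfl | h, h'⟩
        · exact lt_irrefl _ h'
        · exact lt_asymm h' (ha v h)
      simp [hK, this]
    have key : ∀ b ∈ B.filter (a < ·),
        ∑ g ∈ placements S (B.erase b), ∏ i ∈ insert a S,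
          c i (crossAt (insert a S) (Function.update g a b) i)
            (nestAt (insert a S) (Function.update g a b) i) =
        c a #{v ∈ {v ∈ B | a < v} | v < b} #{v ∈ {v ∈ B | a < v} | b < v} *
          if #(insert a S) = #B then ∏ i ∈ S, ∑ r ∈ range (K i), c i r (K i - 1 - r) else 0 := by
      intro b hb
      obtain ⟨hbB, hab⟩ := mem_filter.1 hb
      have hcard : (#S = #(B.erase b)) ↔ #(insert a S) = #B := by
        rw [card_insert_of_notMem haS, card_erase_of_mem hbB]
        have : 0 < #B := card_pos.2 ⟨b, hbB⟩
        omega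
      -- Both `a` and `b` lie above `i`, so deleting them lowers both counts by one: the number of
      -- choices at `i` does not depend on `b`.
      have hKi : ∀ i ∈ S, #{v ∈ B.erase b | i < v} - #{v ∈ S | i < v} = K i := by
        intro i hi
        have h1 : {v ∈ B.erase b | i < v} = {v ∈ B | i < v}.erase b := by
          ext v; simp only [mem_filter, mem_erase]; tauto
        have h2 : b ∈ B.filter (i < ·) := mem_filter.2 ⟨hbB, (ha i hi).trans hab⟩
        have h3 : 0 < #{v ∈ B | i < v} := card_pos.2 ⟨b, h2⟩
        simp only [hK]
        rw [h1, card_erase_of_mem h2, filter_insert, if_pos (ha i hi),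
          card_insert_of_notMem (by simp [haS])]
        omega
      have hI := ih (B.erase b)
      simp only [hcard] at hI
      rw [prod_congr rfl fun i hi => by rw [hKi i hi]] at hI
      rw [← hI, mul_sum]
      refine sum_congr rfl fun g hg => ?_
      rw [prod_insert haS, crossAt_max ha hg, nestAt_max ha hab hg]
      congr 1
      exact prod_congr rfl fun i hi => by
        rw [crossAt_insert_max ha g hi, nestAt_insert_max ha g hi]
    rw [sum_congr rfl key, ← sum_mul, sum_card_lt_card_gt (B.filter (a < ·)) (c a),
      prod_insert haS]
    change _ = if _ then (∑ r ∈ range (K a), c a r (K a - 1 - r)) * _ else 0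
    rw [hKa]
    split_ifs <;> simp [hK]

end Placements

end PermJ

namespace PermJ

/-! ### Lower arcs, by order reversal. -/

section LowerPlacements

open Finset

variable {R : Type*} [CommRing R] {α : Type*} [LinearOrder α]

/-- The functions that restrict to a bijection from `A` onto `B` moving every point down, extended
by the identity. -/
def lowerPlacements [Fintype α] (A B : Finset α) : Finset (α → α) := placements (α := αᵒᵈ) A B

lemma mem_lowerPlacements [Fintype α] {A B : Finset α} {f : α → α} : f ∈ lowerPlacements A B ↔
    (∀ i, i ∉ A → f i = i) ∧ (∀ i ∈ A, f i < i) ∧ Set.InjOn f A ∧ A.image f = B :=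
  mem_placements (α := αᵒᵈ)

/-- The number of arcs of `f` that start after `a` and end between `f a` and `a`. -/
def lowerCrossAt (A : Finset α) (f : α → α) (a : α) : ℕ := #{i ∈ A | a < i ∧ f i < a ∧ f a < f i}

/-- The number of arcs of `f` that start after `a` and end before `f a`. -/
def lowerNestAt (A : Finset α) (f : α → α) (a : α) : ℕ := #{i ∈ A | a < i ∧ f i < f a}

theorem sum_lowerPlacements [Fintype α] (c : α → ℕ → ℕ → R) (A B : Finset α) :
    ∑ f ∈ lowerPlacements A B, ∏ a ∈ A, c a (lowerCrossAt A f a) (lowerNestAt A f a) =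
      if #A = #B then ∏ a ∈ A, ∑ r ∈ range (#{v ∈ B | v < a} - #{v ∈ A | v < a}),
        c a r (#{v ∈ B | v < a} - #{v ∈ A | v < a} - 1 - r) else 0 :=
  sum_placements (α := αᵒᵈ) c A B

end LowerPlacements

/-! ### Permutations as words with two arc placements. -/

section Words

open Finset

variable {n : ℕ}

/-- The type of an index: `none` for a fixed point, and otherwise whether `i < σ i` and whether
`σ⁻¹ i < i`. -/
def stepType (σ : Equiv.Perm (Fin n)) (i : Fin n) : Option (Bool × Bool) :=
  if σ i = i then none else some (decide (i < σ i), decide (σ⁻¹ i < i))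

/-- The positions of excedances in a word of types. -/
def upPos (t : Fin n → Option (Bool × Bool)) : Finset (Fin n) :=
  {i | t i = some (true, true) ∨ t i = some (true, false)}

/-- The values of excedances in a word of types. -/
def upVal (t : Fin n → Option (Bool × Bool)) : Finset (Fin n) :=
  {i | t i = some (true, true) ∨ t i = some (false, true)}

/-- The positions of anti-excedances in a word of types. -/
def downPos (t : Fin n → Option (Bool × Bool)) : Finset (Fin n) :=
  {i | t i = some (false, true) ∨ t i = some (false, false)}

/-- The values of anti-excedances in a word of types. -/
def downVal (t : Fin n → Option (Bool × Bool)) : Finset (Fin n) :=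
  {i | t i = some (true, false) ∨ t i = some (false, false)}

/-- The fixed points of a word of types. -/
def fixPos (t : Fin n → Option (Bool × Bool)) : Finset (Fin n) := {i | t i = none}

lemma inv_lt_iff_of_ne (σ : Equiv.Perm (Fin n)) {i : Fin n} (h : σ i ≠ i) :
    ¬ σ⁻¹ i < i ↔ i < σ⁻¹ i := by
  have : σ⁻¹ i ≠ i := fun h' => h (by rw [Equiv.Perm.inv_eq_iff_eq] at h'; exact h'.symm)
  rw [not_lt]
  exact ⟨fun h' => lt_of_le_of_ne h' this.symm, le_of_lt⟩

lemma inv_eq_self_iff (σ : Equiv.Perm (Fin n)) {i : Fin n} : σ⁻¹ i = i ↔ σ i = i := by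
  rw [Equiv.Perm.inv_eq_iff_eq, eq_comm]

lemma mem_upPos_stepType (σ : Equiv.Perm (Fin n)) (i : Fin n) :
    i ∈ upPos (stepType σ) ↔ i < σ i := by
  rw [upPos, mem_filter_univ, stepType]
  by_cases h : σ i = i
  · simp [h]
  · rw [if_neg h]; cases decide (σ⁻¹ i < i) <;> simp

lemma mem_upVal_stepType (σ : Equiv.Perm (Fin n)) (i : Fin n) :
    i ∈ upVal (stepType σ) ↔ σ⁻¹ i < i := by
  rw [upVal, mem_filter_univ, stepType]
  by_cases h : σ i = i
  · simp [h, (inv_eq_self_iff σ).2 h]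
  · rw [if_neg h]; cases decide (i < σ i) <;> simp

lemma mem_downPos_stepType (σ : Equiv.Perm (Fin n)) (i : Fin n) :
    i ∈ downPos (stepType σ) ↔ σ i < i := by
  rw [downPos, mem_filter_univ, stepType]
  by_cases h : σ i = i
  · simp [h]
  · have h' : σ i < i ↔ ¬ i < σ i := by
      rw [not_lt]; exact lt_iff_le_and_ne.trans (and_iff_left h)
    rw [if_neg h, h']; cases decide (σ⁻¹ i < i) <;> simp

lemma mem_downVal_stepType (σ : Equiv.Perm (Fin n)) (i : Fin n) :
    i ∈ downVal (stepType σ) ↔ i < σ⁻¹ i := by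
  rw [downVal, mem_filter_univ, stepType]
  by_cases h : σ i = i
  · simp [h, (inv_eq_self_iff σ).2 h]
  · rw [if_neg h, ← inv_lt_iff_of_ne σ h]; cases decide (i < σ i) <;> simp

lemma mem_fixPos_stepType (σ : Equiv.Perm (Fin n)) (i : Fin n) :
    i ∈ fixPos (stepType σ) ↔ σ i = i := by
  rw [fixPos, mem_filter_univ, stepType]
  by_cases h : σ i = i <;> simp [h]

/-- `σ` on `A`, and the identity elsewhere. -/
def restrictTo (σ : Fin n → Fin n) (A : Finset (Fin n)) (i : Fin n) : Fin n :=
  if i ∈ A then σ i else i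

lemma restrictTo_upPos_mem (σ : Equiv.Perm (Fin n)) :
    restrictTo σ (upPos (stepType σ)) ∈ placements (upPos (stepType σ)) (upVal (stepType σ)) := by
  have h : ∀ i ∈ upPos (stepType σ), restrictTo σ (upPos (stepType σ)) i = σ i :=
    fun i hi => if_pos hi
  refine mem_placements.2 ⟨fun i hi => if_neg hi, fun i hi => ?_, fun i hi j hj hij => ?_, ?_⟩
  · rw [h i hi]; exact (mem_upPos_stepType σ i).1 hi
  · rw [h i hi, h j hj] at hij; exact σ.injective hij
  · rw [image_congr h]
    ext v
    rw [mem_upVal_stepType, mem_image]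
    constructor
    · rintro ⟨i, hi, rfl⟩
      simpa using (mem_upPos_stepType σ i).1 hi
    · exact fun hv => ⟨σ⁻¹ v, (mem_upPos_stepType σ _).2 (by simpa using hv), by simp⟩

lemma restrictTo_downPos_mem (σ : Equiv.Perm (Fin n)) :
    restrictTo σ (downPos (stepType σ)) ∈
      lowerPlacements (downPos (stepType σ)) (downVal (stepType σ)) := by
  have h : ∀ i ∈ downPos (stepType σ), restrictTo σ (downPos (stepType σ)) i = σ i :=
    fun i hi => if_pos hi
  refine mem_lowerPlacements.2 ⟨fun i hi => if_neg hi, fun i hi => ?_, fun i hi j hj hij => ?_, ?_⟩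
  · rw [h i hi]; exact (mem_downPos_stepType σ i).1 hi
  · rw [h i hi, h j hj] at hij; exact σ.injective hij
  · rw [image_congr h]
    ext v
    rw [mem_downVal_stepType, mem_image]
    constructor
    · rintro ⟨i, hi, rfl⟩
      simpa using (mem_downPos_stepType σ i).1 hi
    · exact fun hv => ⟨σ⁻¹ v, (mem_downPos_stepType σ _).2 (by simpa using hv), by simp⟩

lemma restrictTo_injective {σ τ : Equiv.Perm (Fin n)} (h : stepType σ = stepType τ)
    (h1 : restrictTo σ (upPos (stepType σ)) = restrictTo τ (upPos (stepType τ)))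
    (h2 : restrictTo σ (downPos (stepType σ)) = restrictTo τ (downPos (stepType τ))) : σ = τ := by
  ext1 i
  have e1 := congrFun h1 i
  have e2 := congrFun h2 i
  rw [← h] at e1 e2
  simp only [restrictTo] at e1 e2
  rcases lt_trichotomy (σ i) i with hi | hi | hi
  · simpa [(mem_downPos_stepType σ i).2 hi] using e2
  · have hτ : i ∈ fixPos (stepType τ) := h ▸ (mem_fixPos_stepType σ i).2 hi
    rw [hi, (mem_fixPos_stepType τ i).1 hτ]
  · simpa [(mem_upPos_stepType σ i).2 hi] using e1

/-- Two placements on complementary sets of arcs combine to a permutation. -/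
lemma exists_perm_of_placements (t : Fin n → Option (Bool × Bool)) {f g : Fin n → Fin n}
    (hf : f ∈ placements (upPos t) (upVal t)) (hg : g ∈ lowerPlacements (downPos t) (downVal t)) :
    ∃ σ : Equiv.Perm (Fin n), stepType σ = t ∧ restrictTo σ (upPos t) = f ∧
      restrictTo σ (downPos t) = g := by
  obtain ⟨f1, f2, f3, f4⟩ := mem_placements.1 hf
  obtain ⟨g1, g2, g3, g4⟩ := mem_lowerPlacements.1 hg
  have hfB : ∀ i ∈ upPos t, f i ∈ upVal t := fun i hi => f4 ▸ mem_image_of_mem f hi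
  have hgB : ∀ i ∈ downPos t, g i ∈ downVal t := fun i hi => g4 ▸ mem_image_of_mem g hi
  have hdisj : ∀ i, i ∈ upVal t → i ∉ downVal t := by
    intro i; simp only [upVal, downVal, mem_filter, mem_univ, true_and]
    rintro (h | h) <;> simp [h]
  have hdisj' : ∀ i, i ∈ upPos t → i ∉ downPos t := by
    intro i; simp only [upPos, downPos, mem_filter, mem_univ, true_and]
    rintro (h | h) <;> simp [h]
  have hcov : ∀ i, i ∉ upPos t → i ∉ downPos t → i ∈ fixPos t := by
    intro i; simp only [upPos, downPos, fixPos, mem_filter, mem_univ, true_and]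
    rcases t i with _ | ⟨_ | _, _ | _⟩ <;> simp
  have hcov' : ∀ i, i ∉ upVal t → i ∉ downVal t → i ∈ fixPos t := by
    intro i; simp only [upVal, downVal, fixPos, mem_filter, mem_univ, true_and]
    rcases t i with _ | ⟨_ | _, _ | _⟩ <;> simp
  have hfixV : ∀ i ∈ fixPos t, i ∉ upVal t ∧ i ∉ downVal t := by
    intro i; simp only [upVal, downVal, fixPos, mem_filter, mem_univ, true_and]
    intro h; simp [h]
  -- Since `g` is the identity off `downPos t`, this gluing also fixes the fixed points of the word.
  set k : Fin n → Fin n := fun i => if i ∈ upPos t then f i else g i with hk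
  have ku : ∀ i ∈ upPos t, k i = f i := fun i hi => if_pos hi
  have kd : ∀ i, i ∉ upPos t → k i = g i := fun i hi => if_neg hi
  have kval : ∀ i, i ∉ upPos t → g i ∉ upVal t := by
    intro i hi
    by_cases hd : i ∈ downPos t
    · exact fun h => hdisj _ h (hgB i hd)
    · rw [g1 i hd]; exact (hfixV i (hcov i hi hd)).1
  have kinj : Function.Injective k := by
    intro i j hij
    by_cases hi : i ∈ upPos t <;> by_cases hj : j ∈ upPos t
    · rw [ku i hi, ku j hj] at hij; exact f3 hi hj hij
    · rw [ku i hi, kd j hj] at hij; exact absurd (hij ▸ hfB i hi) (kval j hj)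
    · rw [kd i hi, ku j hj] at hij; exact absurd (hij ▸ hfB j hj) (kval i hi)
    · rw [kd i hi, kd j hj] at hij
      by_cases hi' : i ∈ downPos t <;> by_cases hj' : j ∈ downPos t
      · exact g3 hi' hj' hij
      · rw [g1 j hj'] at hij
        exact absurd (hij ▸ hgB i hi') (hfixV j (hcov j hj hj')).2
      · rw [g1 i hi'] at hij
        exact absurd (hij ▸ hgB j hj') (hfixV i (hcov i hi hi')).2
      · rwa [g1 i hi', g1 j hj'] at hij
  set σ : Equiv.Perm (Fin n) := Equiv.ofBijective k (Finite.injective_iff_bijective.1 kinj) with hσ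
  have hσk : ∀ i, σ i = k i := fun i => rfl
  have sup : ∀ i ∈ upPos t, i < σ i := fun i hi => by rw [hσk, ku i hi]; exact f2 i hi
  have sdown : ∀ i ∈ downPos t, σ i < i := fun i hi => by
    rw [hσk, kd i fun h => hdisj' i h hi]; exact g2 i hi
  have sfix : ∀ i, i ∉ upPos t → i ∉ downPos t → σ i = i := fun i hi hi' => by
    rw [hσk, kd i hi, g1 i hi']
  have vup : ∀ v ∈ upVal t, σ⁻¹ v < v := by
    intro v hv
    rw [← f4, mem_image] at hv
    obtain ⟨i, hi, rfl⟩ := hv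
    have : σ i = f i := by rw [hσk, ku i hi]
    rw [← this, Equiv.Perm.inv_eq_iff_eq.2 rfl]; exact sup i hi
  have vdown : ∀ v ∈ downVal t, v < σ⁻¹ v := by
    intro v hv
    rw [← g4, mem_image] at hv
    obtain ⟨i, hi, rfl⟩ := hv
    have : σ i = g i := by rw [hσk, kd i fun h => hdisj' i h hi]
    rw [← this, Equiv.Perm.inv_eq_iff_eq.2 rfl]; exact sdown i hi
  refine ⟨σ, ?_, ?_, ?_⟩
  · funext i
    unfold stepType
    rcases hti : t i with _ | ⟨u, v⟩
    · rw [if_pos]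
      exact sfix i (by simp [upPos, hti]) (by simp [downPos, hti])
    · have hu : decide (i < σ i) = u ∧ σ i ≠ i := by
        cases u
        · have := sdown i (by cases v <;> simp [downPos, hti])
          simp [this.ne, this.le]
        · have := sup i (by cases v <;> simp [upPos, hti])
          simp [this.ne', this]
      have hv : decide (σ⁻¹ i < i) = v := by
        cases v
        · have := vdown i (by cases u <;> simp [downVal, hti])
          simp only [decide_eq_false_iff_not, not_lt]; exact this.le
        · have := vup i (by cases u <;> simp [upVal, hti])
          simpa only [decide_eq_true_eq] using this
      rw [if_neg hu.2, hu.1, hv]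
  · funext i
    by_cases hi : i ∈ upPos t
    · simp only [restrictTo, if_pos hi]; rw [hσk, ku i hi]
    · simp only [restrictTo, if_neg hi]; rw [f1 i hi]
  · funext i
    by_cases hi : i ∈ downPos t
    · simp only [restrictTo, if_pos hi]; rw [hσk, kd i fun h => hdisj' i h hi]
    · simp only [restrictTo, if_neg hi]; rw [g1 i hi]

end Words

end PermJ

namespace PermJ

/-! ### Sum over the permutations with a given word. -/

section Fibers

open Finset

variable {n : ℕ} (σ : Equiv.Perm (Fin n))

/-- The number of arcs starting before `j` and ending strictly between `j` and `σ j`. -/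
def upCross (j : Fin n) : ℕ := #{i | i < j ∧ j < σ i ∧ σ i < σ j}

/-- The number of arcs starting before `j` and ending after `σ j`. -/
def upNest (j : Fin n) : ℕ := #{i | i < j ∧ σ j < σ i}

/-- The number of arcs starting after `k` and ending strictly between `σ k` and `k`. -/
def downCross (k : Fin n) : ℕ := #{l | k < l ∧ σ l < k ∧ σ k < σ l}

/-- The number of arcs starting after `k` and ending before `σ k`. -/
def downNest (k : Fin n) : ℕ := #{l | k < l ∧ σ l < σ k}

/-- An arc that starts before `i` and ends after it is an excedance, so restricting to `upPos` loses
nothing. The three analogues below rest on the same remark. -/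
lemma upCross_eq_crossAt {i : Fin n} (hi : i ∈ upPos (stepType σ)) :
    upCross σ i = crossAt (upPos (stepType σ)) (restrictTo σ (upPos (stepType σ))) i := by
  unfold upCross crossAt
  congr 1
  ext j
  simp only [mem_filter, mem_univ, true_and]
  by_cases hj : j ∈ upPos (stepType σ)
  · simp [restrictTo, hi, hj]
  · rw [mem_upPos_stepType, not_lt] at hj
    refine ⟨fun h => absurd (h.1.trans h.2.1) hj.not_gt, fun h => ?_⟩
    exact absurd ((mem_upPos_stepType σ j).1 h.1) hj.not_gt

lemma upNest_eq_nestAt {i : Fin n} (hi : i ∈ upPos (stepType σ)) :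
    upNest σ i = nestAt (upPos (stepType σ)) (restrictTo σ (upPos (stepType σ))) i := by
  unfold upNest nestAt
  congr 1
  ext j
  simp only [mem_filter, mem_univ, true_and]
  have hi' := (mem_upPos_stepType σ i).1 hi
  by_cases hj : j ∈ upPos (stepType σ)
  · simp [restrictTo, hi, hj]
  · rw [mem_upPos_stepType, not_lt] at hj
    refine ⟨fun h => absurd ((h.1.trans hi').trans h.2) hj.not_gt, fun h => ?_⟩
    exact absurd ((mem_upPos_stepType σ j).1 h.1) hj.not_gt

lemma downCross_eq_lowerCrossAt {i : Fin n} (hi : i ∈ downPos (stepType σ)) :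
    downCross σ i =
      lowerCrossAt (downPos (stepType σ)) (restrictTo σ (downPos (stepType σ))) i := by
  unfold downCross lowerCrossAt
  congr 1
  ext j
  simp only [mem_filter, mem_univ, true_and]
  by_cases hj : j ∈ downPos (stepType σ)
  · simp [restrictTo, hi, hj]
  · rw [mem_downPos_stepType, not_lt] at hj
    refine ⟨fun h => absurd (h.2.1.trans h.1) hj.not_gt, fun h => ?_⟩
    exact absurd ((mem_downPos_stepType σ j).1 h.1) hj.not_gt

lemma downNest_eq_lowerNestAt {i : Fin n} (hi : i ∈ downPos (stepType σ)) :
    downNest σ i =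
      lowerNestAt (downPos (stepType σ)) (restrictTo σ (downPos (stepType σ))) i := by
  unfold downNest lowerNestAt
  congr 1
  ext j
  simp only [mem_filter, mem_univ, true_and]
  have hi' := (mem_downPos_stepType σ i).1 hi
  by_cases hj : j ∈ downPos (stepType σ)
  · simp [restrictTo, hi, hj]
  · rw [mem_downPos_stepType, not_lt] at hj
    refine ⟨fun h => absurd ((h.2.trans hi').trans h.1) hj.not_gt, fun h => ?_⟩
    exact absurd ((mem_downPos_stepType σ j).1 h.1) hj.not_gt

/-- The number of open arcs before position `i`. -/
def height (t : Fin n → Option (Bool × Bool)) (i : Fin n) : ℤ :=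
  #{j ∈ upPos t | j < i} - #{j ∈ upVal t | j < i}

/-- No other arc ends at a fixed point, so the upper arcs open before `i` are exactly those passing
over it. -/
lemma psnestAt_eq_height {i : Fin n} (hi : σ i = i) :
    psnestAt σ i = (height (stepType σ) i).toNat := by
  have e1 : #{j ∈ upPos (stepType σ) | j < i} =
      psnestAt σ i + #{j ∈ upPos (stepType σ) | σ j < i} := by
    unfold psnestAt
    rw [← card_union_of_disjoint]
    · congr 1
      ext j
      have hne : σ j = i → j = i := fun h => σ.injective (h.trans hi.symm)
      simp only [mem_filter, mem_union, mem_univ, true_and, mem_upPos_stepType]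
      constructor
      · rintro ⟨h1, h2⟩
        rcases lt_trichotomy (σ j) i with h | h | h
        · exact Or.inr ⟨h1, h⟩
        · exact absurd (hne h) h2.ne
        · exact Or.inl ⟨h2, h⟩
      · rintro (⟨h1, h2⟩ | ⟨h1, h2⟩)
        · exact ⟨h1.trans h2, h1⟩
        · exact ⟨h1, h1.trans h2⟩
    · rw [disjoint_left]
      intro j h1 h2
      exact lt_asymm (mem_filter.1 h1).2.2 (mem_filter.1 h2).2
  have e2 : #{j ∈ upVal (stepType σ) | j < i} = #{j ∈ upPos (stepType σ) | σ j < i} := by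
    rw [← card_image_of_injective {j ∈ upPos (stepType σ) | σ j < i} σ.injective]
    congr 1
    ext v
    simp only [mem_filter, mem_image, mem_upPos_stepType, mem_upVal_stepType]
    constructor
    · rintro ⟨h1, h2⟩
      exact ⟨σ⁻¹ v, ⟨by simpa using h1, by simpa using h2⟩, by simp⟩
    · rintro ⟨j, ⟨h1, h2⟩, rfl⟩
      exact ⟨by simpa using h1, h2⟩
  rw [height, e1, e2]; omega

variable {R : Type*} [CommRing R]

/-- The weight of index `i` in `σ`: `F` of the level at a fixed point, and `W` of the type of `i`
and its numbers of crossings and nestings otherwise. -/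
def indexWeight (W : Bool × Bool → ℕ → ℕ → R) (F : ℕ → R) (i : Fin n) : R :=
  match stepType σ i with
  | none => F (psnestAt σ i)
  | some (true, v) => W (true, v) (upCross σ i) (upNest σ i)
  | some (false, v) => W (false, v) (downCross σ i) (downNest σ i)

/-- The sum of `w` over the `N` ways to be crossed and nested by the `N - 1` other open arcs. -/
def rankSum (w : ℕ → ℕ → R) (N : ℕ) : R := ∑ r ∈ range N, w r (N - 1 - r)

/-- The total weight of a step of given type at height `h`. -/
def stepWeight (W : Bool × Bool → ℕ → ℕ → R) (F : ℕ → R) : Option (Bool × Bool) → ℤ → R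
  | none, h => F h.toNat
  | some (true, false), h => rankSum (W (true, false)) (h + 1).toNat
  | some (true, true), h => rankSum (W (true, true)) h.toNat
  | some (false, v), h => rankSum (W (false, v)) h.toNat

lemma prod_univ_split (t : Fin n → Option (Bool × Bool)) (X : Fin n → R) :
    ∏ i, X i = (∏ i ∈ upPos t, X i) * (∏ i ∈ downPos t, X i) * ∏ i ∈ fixPos t, X i := by
  simp only [upPos, downPos, fixPos, prod_filter, ← prod_mul_distrib]
  refine prod_congr rfl fun i _ => ?_
  rcases t i with _ | ⟨_ | _, _ | _⟩ <;> simp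

/-- Each non-fixed index is one position and one value. Applied to the indices before `i`, this
makes the open lower arcs as numerous as the open upper ones. -/
lemma card_upPos_add_downPos (t : Fin n → Option (Bool × Bool)) (p : Fin n → Prop)
    [DecidablePred p] :
    #{j ∈ upPos t | p j} + #{j ∈ downPos t | p j} =
      #{j ∈ upVal t | p j} + #{j ∈ downVal t | p j} := by
  simp only [upPos, downPos, upVal, downVal, filter_filter, card_filter, ← sum_add_distrib]
  refine sum_congr rfl fun i _ => ?_
  rcases t i with _ | ⟨_ | _, _ | _⟩ <;> simp

lemma card_gt_add_card_lt (A : Finset (Fin n)) (i : Fin n) :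
    #{j ∈ A | i < j} + #{j ∈ A | j < i} + (if i ∈ A then 1 else 0) = #A := by
  have : (if i ∈ A then 1 else 0) = #{j ∈ A | j = i} := by
    rw [filter_eq']; split_ifs <;> simp
  rw [this, card_eq_sum_ones A]
  simp only [card_filter, ← sum_add_distrib]
  refine sum_congr rfl fun j _ => ?_
  rcases lt_trichotomy i j with h | h | h
  · simp [h, h.not_gt, h.ne']
  · simp [h]
  · simp [h, h.not_gt, h.ne]

/-- The candidates are the upper arcs open just after `i`: one more than the height at a valley, and
equal to the height at a double rise, where `i` also closes an arc. Balance of the word turns counts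
after `i` into counts before it. -/
lemma rankSum_upPos (W : Bool × Bool → ℕ → ℕ → R) (F : ℕ → R) (t : Fin n → Option (Bool × Bool))
    (h : #(upPos t) = #(upVal t)) {i : Fin n} {v : Bool} (hi : t i = some (true, v)) :
    rankSum (W (true, v)) (#{j ∈ upVal t | i < j} - #{j ∈ upPos t | i < j}) =
      stepWeight W F (t i) (height t i) := by
  have h1 := card_gt_add_card_lt (upPos t) i
  have h2 := card_gt_add_card_lt (upVal t) i
  have e1 : i ∈ upPos t := by cases v <;> simp [upPos, hi]
  rw [if_pos e1] at h1
  unfold height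
  cases v
  · have e2 : i ∉ upVal t := by simp [upVal, hi]
    rw [if_neg e2] at h2
    rw [hi, stepWeight]
    congr 1; omega
  · have e2 : i ∈ upVal t := by simp [upVal, hi]
    rw [if_pos e2] at h2
    rw [hi, stepWeight]
    congr 1; omega

lemma rankSum_downPos (W : Bool × Bool → ℕ → ℕ → R) (F : ℕ → R) (t : Fin n → Option (Bool × Bool))
    {i : Fin n} {v : Bool} (hi : t i = some (false, v)) :
    rankSum (W (false, v)) (#{j ∈ downVal t | j < i} - #{j ∈ downPos t | j < i}) =
      stepWeight W F (t i) (height t i) := by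
  have h := card_upPos_add_downPos t (· < i)
  rw [hi, stepWeight, height]
  congr 1; omega

theorem sum_fiber (W : Bool × Bool → ℕ → ℕ → R) (F : ℕ → R) (t : Fin n → Option (Bool × Bool)) :
    ∑ σ : Equiv.Perm (Fin n) with stepType σ = t, ∏ i, indexWeight σ W F i =
      if #(upPos t) = #(upVal t) then ∏ i, stepWeight W F (t i) (height t i) else 0 := by
  -- The value at `none` is a dummy: `c` is evaluated only on `upPos t` and `downPos t`.
  set c : Fin n → ℕ → ℕ → R := fun i => match t i with
    | none => fun _ _ => 0
    | some τ => W τ with hc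
  have key : ∑ σ : Equiv.Perm (Fin n) with stepType σ = t, ∏ i, indexWeight σ W F i =
      ∑ p ∈ placements (upPos t) (upVal t) ×ˢ lowerPlacements (downPos t) (downVal t),
        (∏ i ∈ upPos t, c i (crossAt (upPos t) p.1 i) (nestAt (upPos t) p.1 i)) *
        (∏ i ∈ downPos t, c i (lowerCrossAt (downPos t) p.2 i) (lowerNestAt (downPos t) p.2 i)) *
        ∏ i ∈ fixPos t, F (height t i).toNat := by
    refine sum_bij (fun σ _ => (restrictTo σ (upPos t), restrictTo σ (downPos t))) ?_ ?_ ?_ ?_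
    · intro σ hσ
      obtain rfl := (mem_filter.1 hσ).2
      exact mem_product.2 ⟨restrictTo_upPos_mem σ, restrictTo_downPos_mem σ⟩
    · intro σ hσ τ hτ h
      obtain rfl := (mem_filter.1 hσ).2
      have hτ' := (mem_filter.1 hτ).2
      rw [Prod.mk.injEq] at h
      exact restrictTo_injective hτ'.symm (hτ' ▸ h.1) (hτ' ▸ h.2)
    · rintro ⟨f, g⟩ h
      obtain ⟨hf, hg⟩ := mem_product.1 h
      obtain ⟨σ, h1, h2, h3⟩ := exists_perm_of_placements t hf hg
      exact ⟨σ, by simpa using h1, by rw [h2, h3]⟩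
    · intro σ hσ
      obtain rfl := (mem_filter.1 hσ).2
      rw [prod_univ_split (stepType σ)]
      congr 1
      · congr 1
        · refine prod_congr rfl fun i hi => ?_
          rw [← upCross_eq_crossAt σ hi, ← upNest_eq_nestAt σ hi]
          rcases (mem_filter.1 hi).2 with h | h <;> simp only [hc, indexWeight, h]
        · refine prod_congr rfl fun i hi => ?_
          rw [← downCross_eq_lowerCrossAt σ hi, ← downNest_eq_lowerNestAt σ hi]
          rcases (mem_filter.1 hi).2 with h | h <;> simp only [hc, indexWeight, h]
      · refine prod_congr rfl fun i hi => ?_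
        rw [← psnestAt_eq_height σ ((mem_fixPos_stepType σ i).1 hi)]
        simp only [indexWeight, (mem_filter.1 hi).2]
  rw [key, ← sum_mul, sum_product]
  dsimp only
  rw [← sum_mul_sum, sum_placements, sum_lowerPlacements]
  have hcard : #(upPos t) = #(upVal t) → #(downPos t) = #(downVal t) := by
    intro h
    have := card_upPos_add_downPos t fun _ => True
    simp only [filter_true] at this
    omega
  by_cases h : #(upPos t) = #(upVal t)
  · rw [if_pos h, if_pos h, if_pos (hcard h), prod_univ_split t]
    congr 1
    · congr 1
      · refine prod_congr rfl fun i hi => ?_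
        rcases (mem_filter.1 hi).2 with hi' | hi' <;>
          rw [← rankSum_upPos W F t h hi'] <;> simp only [hc, hi', rankSum]
      · refine prod_congr rfl fun i hi => ?_
        rcases (mem_filter.1 hi).2 with hi' | hi' <;>
          rw [← rankSum_downPos W F t hi'] <;> simp only [hc, hi', rankSum]
    · exact prod_congr rfl fun i hi => by rw [(mem_filter.1 hi).2, stepWeight]
  · simp [h]

end Fibers

/-! ### Words of types as Motzkin paths. -/

section WordSum

open Finset

variable {R : Type*} [CommRing R]

lemma height_cons_zero {m : ℕ} (τ : Option (Bool × Bool)) (t : Fin m → Option (Bool × Bool)) :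
    height (Fin.cons τ t : Fin (m + 1) → Option (Bool × Bool)) 0 = 0 := by
  simp [height]

/-- The height change along a step. -/
def stepRise : Option (Bool × Bool) → ℤ
  | some (true, false) => 1
  | some (false, true) => -1
  | _ => 0

lemma height_cons_succ {m : ℕ} (τ : Option (Bool × Bool)) (t : Fin m → Option (Bool × Bool))
    (i : Fin m) :
    height (Fin.cons τ t : Fin (m + 1) → Option (Bool × Bool)) i.succ =
      stepRise τ + height t i := by
  simp only [height, upPos, upVal, filter_filter, card_filter, Fin.sum_univ_succ, Fin.cons_zero,
    Fin.cons_succ, Fin.succ_lt_succ_iff, Fin.succ_pos, and_true]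
  rcases τ with _ | ⟨_ | _, _ | _⟩ <;> simp [stepRise] <;> ring

lemma card_sub_card_cons {m : ℕ} (τ : Option (Bool × Bool)) (t : Fin m → Option (Bool × Bool)) :
    (#(upPos (Fin.cons τ t : Fin (m + 1) → Option (Bool × Bool))) : ℤ)
      - #(upVal (Fin.cons τ t : Fin (m + 1) → Option (Bool × Bool))) =
      stepRise τ + (#(upPos t) - #(upVal t)) := by
  simp only [upPos, upVal, card_filter, Fin.sum_univ_succ, Fin.cons_zero, Fin.cons_succ]
  rcases τ with _ | ⟨_ | _, _ | _⟩ <;> simp [stepRise] <;> ring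

/-- Splitting off the first letter reproduces the recursion of `motzkin`; the starting height `h` is
kept general for this induction. -/
theorem sum_words (W : Bool × Bool → ℕ → ℕ → R) (F : ℕ → R) (m h : ℕ) :
    ∑ t : Fin m → Option (Bool × Bool),
      (if (h : ℤ) + (#(upPos t) - #(upVal t)) = 0 then
        ∏ i, stepWeight W F (t i) (h + height t i) else 0) =
      motzkin (fun h => rankSum (W (true, false)) (h + 1))
        (fun h => F h + rankSum (W (true, true)) h + rankSum (W (false, false)) h)
        (fun h => rankSum (W (false, true)) h) m h := by
  induction m generalizing h with
  | zero => simp [upPos, upVal, motzkin]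
  | succ m ih =>
    rw [← (Fin.consEquiv fun _ => Option (Bool × Bool)).sum_comp, Fintype.sum_prod_type]
    have step : ∀ τ : Option (Bool × Bool), ∀ h' : ℕ, (h : ℤ) + stepRise τ = h' →
        ∑ t : Fin m → Option (Bool × Bool),
          (if (h : ℤ) + (#(upPos (Fin.consEquiv (fun _ => Option (Bool × Bool)) (τ, t)))
            - #(upVal (Fin.consEquiv (fun _ => Option (Bool × Bool)) (τ, t)))) = 0 then
          ∏ i, stepWeight W F (Fin.consEquiv (fun _ => Option (Bool × Bool)) (τ, t) i)
            (h + height (Fin.consEquiv (fun _ => Option (Bool × Bool)) (τ, t)) i) else 0) =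
        stepWeight W F τ h * motzkin (fun h => rankSum (W (true, false)) (h + 1))
          (fun h => F h + rankSum (W (true, true)) h + rankSum (W (false, false)) h)
          (fun h => rankSum (W (false, true)) h) m h' := by
      intro τ h' hh
      rw [← ih h', mul_sum]
      refine sum_congr rfl fun t _ => ?_
      change (if (h : ℤ) + (#(upPos (Fin.cons τ t : Fin (m + 1) → Option (Bool × Bool)))
            - #(upVal (Fin.cons τ t : Fin (m + 1) → Option (Bool × Bool)))) = 0 then
          ∏ i, stepWeight W F ((Fin.cons τ t : Fin (m + 1) → Option (Bool × Bool)) i)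
            (h + height (Fin.cons τ t : Fin (m + 1) → Option (Bool × Bool)) i) else 0) = _
      rw [card_sub_card_cons, Fin.prod_univ_succ, height_cons_zero, ← add_assoc, hh]
      simp only [height_cons_succ, ← add_assoc, hh, Fin.cons_zero, Fin.cons_succ, add_zero,
        mul_ite, mul_zero]
    simp only [Fintype.sum_option, Fintype.sum_prod_type, Fintype.sum_bool]
    rw [step none h (by simp [stepRise]), step (some (true, true)) h (by simp [stepRise]),
      step (some (false, false)) h (by simp [stepRise]),
      step (some (true, false)) (h + 1) (by simp [stepRise])]
    cases h with
    | zero =>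
      -- A fall at height 0 has an empty `rankSum`, so words that descend below 0 contribute
      -- nothing.
      have hz : ∀ t : Fin m → Option (Bool × Bool),
          ∏ i, stepWeight W F (Fin.consEquiv (fun _ => Option (Bool × Bool))
              (some (false, true), t) i)
            ((0 : ℕ) + height (Fin.consEquiv (fun _ => Option (Bool × Bool))
              (some (false, true), t)) i) = 0 := by
        intro t
        change ∏ i, stepWeight W F ((Fin.cons (some (false, true)) t :
          Fin (m + 1) → Option (Bool × Bool)) i) ((0 : ℕ) + height (Fin.cons (some (false, true)) t :
          Fin (m + 1) → Option (Bool × Bool)) i) = 0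
        rw [Fin.prod_univ_succ, height_cons_zero]
        simp [stepWeight, rankSum]
      simp only [hz, ite_self, sum_const_zero]
      simp [stepWeight, motzkin, rankSum]
      ring
    | succ h =>
      rw [step (some (false, true)) h (by simp [stepRise])]
      have e : ((h + 1 : ℕ) + 1 : ℤ).toNat = h + 2 := by omega
      simp only [stepWeight, motzkin, Int.toNat_natCast, e]
      ring

/-- The sum over permutations of a product of local weights counts weighted Motzkin paths. -/
theorem sum_perm_eq_motzkin (W : Bool × Bool → ℕ → ℕ → R) (F : ℕ → R) (n : ℕ) :
    ∑ σ : Equiv.Perm (Fin n), ∏ i, indexWeight σ W F i =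
      motzkin (fun h => rankSum (W (true, false)) (h + 1))
        (fun h => F h + rankSum (W (true, true)) h + rankSum (W (false, false)) h)
        (fun h => rankSum (W (false, true)) h) n 0 := by
  rw [← sum_words, ← sum_fiberwise univ (fun σ => stepType σ)]
  refine sum_congr rfl fun t _ => ?_
  rw [sum_fiber]
  simp [sub_eq_zero]

end WordSum

end PermJ

namespace PermJ

/-! ### Statistics and sign as sums over indices. -/

section LocalStatistics

open Finset

variable {n : ℕ} (σ : Equiv.Perm (Fin n))

/-- Two entries of such a quadruple are images of the other two, so only pairs need counting,
grouped by the index whose cycle type is recorded. -/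
lemma card_quadruples_left (Q : Fin n → Fin n → Fin n → Fin n → Prop)
    [∀ i j k l, Decidable (Q i j k l)] (f : Fin n → Fin n)
    (p : Fin n → Prop) [DecidablePred p] (q : Fin n → Fin n → Prop) [∀ i j, Decidable (q i j)]
    (h : ∀ i j k l, Q i j k l ↔ k = f i ∧ l = f j ∧ p j ∧ q i j) :
    #{(i, j, k, l) : Fin n × Fin n × Fin n × Fin n | Q i j k l} = ∑ j with p j, #{i | q i j} := by
  rw [← card_sigma]
  refine card_nbij' (fun x => ⟨x.2.1, x.1⟩) (fun y => (y.2, y.1, f y.2, f y.1)) ?_ ?_ ?_ ?_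
  · rintro ⟨i, j, k, l⟩ hx
    simp only [coe_filter, mem_univ, true_and, Set.mem_ofPred_eq, h] at hx
    simp [hx]
  · rintro ⟨j, i⟩ hy
    simpa [h] using hy
  · rintro ⟨i, j, k, l⟩ hx
    simp only [coe_filter, mem_univ, true_and, Set.mem_ofPred_eq, h] at hx
    simp [hx]
  · rintro ⟨j, i⟩ hy; rfl

lemma card_quadruples_right (Q : Fin n → Fin n → Fin n → Fin n → Prop)
    [∀ i j k l, Decidable (Q i j k l)] (f : Fin n → Fin n)
    (p : Fin n → Prop) [DecidablePred p] (q : Fin n → Fin n → Prop) [∀ i j, Decidable (q i j)]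
    (h : ∀ i j k l, Q i j k l ↔ i = f k ∧ j = f l ∧ p k ∧ q k l) :
    #{(i, j, k, l) : Fin n × Fin n × Fin n × Fin n | Q i j k l} = ∑ k with p k, #{l | q k l} := by
  rw [← card_sigma]
  refine card_nbij' (fun x => ⟨x.2.2.1, x.2.2.2⟩)
    (fun y => (f y.1, f y.2, y.1, y.2)) ?_ ?_ ?_ ?_
  · rintro ⟨i, j, k, l⟩ hx
    simp only [coe_filter, mem_univ, true_and, Set.mem_ofPred_eq, h] at hx
    simp [hx]
  · rintro ⟨j, i⟩ hy
    simpa [h] using hy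
  · rintro ⟨i, j, k, l⟩ hx
    simp only [coe_filter, mem_univ, true_and, Set.mem_ofPred_eq, h] at hx
    simp [hx]
  · rintro ⟨j, i⟩ hy; rfl

lemma ucrosscval_eq_sum : ucrosscval σ = ∑ j with IsCval σ j, upCross σ j :=
  card_quadruples_left (fun i j k l => IsUcross σ i j k l ∧ j < σ⁻¹ j) σ
    (IsCval σ) (fun i j => i < j ∧ j < σ i ∧ σ i < σ j) (by
    rintro i j k l
    constructor
    · rintro ⟨⟨h1, h2, h3, rfl, rfl⟩, h6⟩
      exact ⟨rfl, rfl, ⟨h6, h2.trans h3⟩, h1, h2, h3⟩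
    · rintro ⟨rfl, rfl, ⟨h1, h2⟩, h3, h4, h5⟩
      exact ⟨⟨h3, h4, h5, rfl, rfl⟩, h1⟩)

lemma ucrosscdrise_eq_sum : ucrosscdrise σ = ∑ j with IsCdrise σ j, upCross σ j :=
  card_quadruples_left (fun i j k l => IsUcross σ i j k l ∧ σ⁻¹ j < j) σ
    (IsCdrise σ) (fun i j => i < j ∧ j < σ i ∧ σ i < σ j) (by
    rintro i j k l
    constructor
    · rintro ⟨⟨h1, h2, h3, rfl, rfl⟩, h6⟩
      exact ⟨rfl, rfl, ⟨h6, h2.trans h3⟩, h1, h2, h3⟩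
    · rintro ⟨rfl, rfl, ⟨h1, h2⟩, h3, h4, h5⟩
      exact ⟨⟨h3, h4, h5, rfl, rfl⟩, h1⟩)

lemma unestcval_eq_sum : unestcval σ = ∑ j with IsCval σ j, upNest σ j := by
  -- Swapping the last two entries turns a nesting into the pattern `k = f i`, `l = f j` of the
  -- counting lemma.
  have h := card_quadruples_left (fun i j l k => IsUnest σ i j k l ∧ j < σ⁻¹ j) σ (IsCval σ)
    (fun i j => i < j ∧ σ j < σ i) (by
      rintro i j l k
      constructor
      · rintro ⟨⟨h1, h2, h3, rfl, rfl⟩, h6⟩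
        exact ⟨rfl, rfl, ⟨h6, h2⟩, h1, h3⟩
      · rintro ⟨rfl, rfl, ⟨h1, h2⟩, h3, h4⟩
        exact ⟨⟨h3, h2, h4, rfl, rfl⟩, h1⟩)
  rw [unestcval]
  refine Eq.trans ?_ h
  exact card_nbij' (fun x => (x.1, x.2.1, x.2.2.2, x.2.2.1))
    (fun x => (x.1, x.2.1, x.2.2.2, x.2.2.1)) (fun x hx => by simpa using hx)
    (fun x hx => by simpa using hx) (fun x _ => rfl) (fun x _ => rfl)

lemma unestcdrise_eq_sum : unestcdrise σ = ∑ j with IsCdrise σ j, upNest σ j := by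
  have h := card_quadruples_left (fun i j l k => IsUnest σ i j k l ∧ σ⁻¹ j < j) σ (IsCdrise σ)
    (fun i j => i < j ∧ σ j < σ i) (by
      rintro i j l k
      constructor
      · rintro ⟨⟨h1, h2, h3, rfl, rfl⟩, h6⟩
        exact ⟨rfl, rfl, ⟨h6, h2⟩, h1, h3⟩
      · rintro ⟨rfl, rfl, ⟨h1, h2⟩, h3, h4⟩
        exact ⟨⟨h3, h2, h4, rfl, rfl⟩, h1⟩)
  rw [unestcdrise]
  refine Eq.trans ?_ h
  exact card_nbij' (fun x => (x.1, x.2.1, x.2.2.2, x.2.2.1))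
    (fun x => (x.1, x.2.1, x.2.2.2, x.2.2.1)) (fun x hx => by simpa using hx)
    (fun x hx => by simpa using hx) (fun x _ => rfl) (fun x _ => rfl)

lemma lcrosscpeak_eq_sum : lcrosscpeak σ = ∑ k with IsCpeak σ k, downCross σ k :=
  card_quadruples_right (fun i j k l => IsLcross σ i j k l ∧ σ⁻¹ k < k) σ
    (IsCpeak σ) (fun k l => k < l ∧ σ l < k ∧ σ k < σ l) (by
    rintro i j k l
    constructor
    · rintro ⟨⟨h1, h2, h3, rfl, rfl⟩, h6⟩
      exact ⟨rfl, rfl, ⟨h6, h1.trans h2⟩, h3, h2, h1⟩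
    · rintro ⟨rfl, rfl, ⟨h1, h2⟩, h3, h4, h5⟩
      exact ⟨⟨h5, h4, h3, rfl, rfl⟩, h1⟩)

lemma lcrosscdfall_eq_sum : lcrosscdfall σ = ∑ k with IsCdfall σ k, downCross σ k :=
  card_quadruples_right (fun i j k l => IsLcross σ i j k l ∧ k < σ⁻¹ k) σ
    (IsCdfall σ) (fun k l => k < l ∧ σ l < k ∧ σ k < σ l) (by
    rintro i j k l
    constructor
    · rintro ⟨⟨h1, h2, h3, rfl, rfl⟩, h6⟩
      exact ⟨rfl, rfl, ⟨h6, h1.trans h2⟩, h3, h2, h1⟩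
    · rintro ⟨rfl, rfl, ⟨h1, h2⟩, h3, h4, h5⟩
      exact ⟨⟨h5, h4, h3, rfl, rfl⟩, h1⟩)

lemma lnestcpeak_eq_sum : lnestcpeak σ = ∑ k with IsCpeak σ k, downNest σ k := by
  have h := card_quadruples_right (fun j i k l => IsLnest σ i j k l ∧ σ⁻¹ k < k) σ (IsCpeak σ)
    (fun k l => k < l ∧ σ l < σ k) (by
      rintro j i k l
      constructor
      · rintro ⟨⟨h1, h2, h3, rfl, rfl⟩, h6⟩
        exact ⟨rfl, rfl, ⟨h6, h2⟩, h3, h1⟩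
      · rintro ⟨rfl, rfl, ⟨h1, h2⟩, h3, h4⟩
        exact ⟨⟨h4, h2, h3, rfl, rfl⟩, h1⟩)
  rw [lnestcpeak]
  refine Eq.trans ?_ h
  exact card_nbij' (fun x => (x.2.1, x.1, x.2.2)) (fun x => (x.2.1, x.1, x.2.2))
    (fun x hx => by simpa using hx) (fun x hx => by simpa using hx) (fun x _ => rfl)
    (fun x _ => rfl)

lemma lnestcdfall_eq_sum : lnestcdfall σ = ∑ k with IsCdfall σ k, downNest σ k := by
  have h := card_quadruples_right (fun j i k l => IsLnest σ i j k l ∧ k < σ⁻¹ k) σ (IsCdfall σ)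
    (fun k l => k < l ∧ σ l < σ k) (by
      rintro j i k l
      constructor
      · rintro ⟨⟨h1, h2, h3, rfl, rfl⟩, h6⟩
        exact ⟨rfl, rfl, ⟨h6, h2⟩, h3, h1⟩
      · rintro ⟨rfl, rfl, ⟨h1, h2⟩, h3, h4⟩
        exact ⟨⟨h4, h2, h3, rfl, rfl⟩, h1⟩)
  rw [lnestcdfall]
  refine Eq.trans ?_ h
  exact card_nbij' (fun x => (x.2.1, x.1, x.2.2)) (fun x => (x.2.1, x.1, x.2.2))
    (fun x hx => by simpa using hx) (fun x hx => by simpa using hx) (fun x _ => rfl)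
    (fun x _ => rfl)

lemma psnest_eq_sum : psnest σ = ∑ j with σ j = j, psnestAt σ j := by
  unfold psnest psnestAt
  rw [← card_sigma]
  refine card_nbij' (fun x => ⟨x.2.1, x.1⟩) (fun y => (y.2, y.1, σ y.2)) ?_ ?_ ?_ ?_
  · rintro ⟨i, j, l⟩ hx
    simp only [coe_filter, mem_univ, true_and, Set.mem_ofPred_eq] at hx
    obtain ⟨h1, h2, rfl, h4⟩ := hx
    simp [h1, h2, ← h4]
  · rintro ⟨j, i⟩ hy
    simp only [coe_sigma, Set.mem_sigma_iff, coe_filter, mem_univ, true_and,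
      Set.mem_ofPred_eq] at hy
    simp [hy]
  · rintro ⟨i, j, l⟩ hx
    simp only [coe_filter, mem_univ, true_and, Set.mem_ofPred_eq] at hx
    obtain ⟨-, -, rfl, -⟩ := hx
    rfl
  · rintro ⟨j, i⟩ hy; rfl

/-! ### Records -/

lemma isRec_iff {i : Fin n} : IsRec σ i ↔ upNest σ i = 0 := by
  rw [upNest, card_eq_zero, filter_eq_empty_iff]
  constructor
  · exact fun h j _ hj => lt_asymm (h j hj.1) hj.2
  · intro h j hj
    refine lt_of_le_of_ne (not_lt.1 fun h' => h (mem_univ j) ⟨hj, h'⟩) fun e => ?_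
    exact hj.ne (σ.injective e)

lemma isArec_iff {i : Fin n} : IsArec σ i ↔ downNest σ i = 0 := by
  rw [downNest, card_eq_zero, filter_eq_empty_iff]
  constructor
  · exact fun h j _ hj => lt_asymm (h j hj.1) hj.2
  · intro h j hj
    refine lt_of_le_of_ne (not_lt.1 fun h' => h (mem_univ j) ⟨hj, h'⟩) fun e => ?_
    exact hj.ne (σ.injective e)

lemma card_filter_val_lt (i : Fin n) : #{j | σ j < i} = (i : ℕ) := by
  rw [← Fin.card_Iio i, ← card_map σ.toEmbedding]
  congr 1
  ext j
  simp only [mem_map_equiv, mem_filter, mem_univ, true_and, Equiv.apply_symm_apply, mem_Iio]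

lemma card_filter_lt (i : Fin n) : #{j | j < i} = (i : ℕ) := card_filter_val_lt 1 i

/-- Counting the values below `σ i` by their positions. -/
lemma downNest_add_val (i : Fin n) : downNest σ i + i = upNest σ i + σ i := by
  rw [← card_filter_val_lt σ (σ i), ← card_filter_lt i, downNest, upNest]
  simp only [card_filter, ← sum_add_distrib]
  refine sum_congr rfl fun j _ => ?_
  rcases lt_trichotomy i j with h | rfl | h
  · simp [h, h.not_gt]
  · simp
  · have hne : σ j ≠ σ i := fun e => h.ne (σ.injective e)
    rcases lt_or_gt_of_ne hne with h' | h' <;> simp [h, h', h.not_gt, h'.not_gt]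

/-- So an excedance is never an antirecord, and being an exclusive record depends on `upNest` alone.
Dually for `upNest_pos`. -/
lemma downNest_pos {i : Fin n} (h : i < σ i) : 0 < downNest σ i := by
  have := downNest_add_val σ i
  have : (i : ℕ) < σ i := h
  omega

lemma upNest_pos {i : Fin n} (h : σ i < i) : 0 < upNest σ i := by
  have := downNest_add_val σ i
  have : (σ i : ℕ) < i := h
  omega

/-! ### The sign -/

/-- The number of inversions starting at an excedance `i`. -/
lemma downNest_eq_of_lt {i : Fin n} (h : i < σ i) :
    downNest σ i = 1 + upNest σ i + #{k | i < k ∧ k < σ i} := by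
  have h1 := downNest_add_val σ i
  have h2 : #{k | i < k ∧ k < σ i} = (σ i : ℕ) - i - 1 := by
    rw [← Fin.card_Ioo]; congr 1; ext k; simp
  have : (i : ℕ) < σ i := h
  omega

lemma psnestAt_of_lt {k : Fin n} (h : k < σ k) : psnestAt σ k = upCross σ k + upNest σ k := by
  unfold psnestAt upCross upNest
  simp only [card_filter, ← sum_add_distrib]
  refine sum_congr rfl fun j _ => ?_
  rcases lt_trichotomy (σ j) (σ k) with h' | h' | h'
  · simp [h', h'.not_gt]
  · rw [σ.injective h']; simp
  · simp [h', h'.not_gt, h.trans h']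

/-- As many values as positions lie below `k`, so equally many arcs cross the cut just before `k` in
each direction. Upward arcs pass over `k` or end at `k`; downward ones are those counted by
`downCross` and `downNest`, and the arc of `k` itself. -/
lemma psnestAt_of_gt {k : Fin n} (h : σ k < k) :
    psnestAt σ k + (if σ⁻¹ k < k then 1 else 0) = downCross σ k + downNest σ k + 1 := by
  have e1 : (if σ⁻¹ k < k then 1 else 0) = #{j | j < k ∧ σ j = k} := by
    have : univ.filter (fun j => j < k ∧ σ j = k) =
        univ.filter (fun j => j = σ⁻¹ k ∧ σ⁻¹ k < k) := by
      ext j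
      simp only [mem_filter, mem_univ, true_and, Equiv.Perm.eq_inv_iff_eq]
      constructor
      · rintro ⟨h1, rfl⟩; simpa using h1
      · rintro ⟨rfl, h1⟩; simpa using h1
    rw [this]
    split_ifs with hk
    · simp only [hk, and_true, filter_eq', mem_univ, if_true, card_singleton]
    · simp only [hk, and_false, filter_false, card_empty]
  have e2 : 1 = #{j : Fin n | j = k} := by
    rw [filter_eq', if_pos (mem_univ k), card_singleton]
  have e3 : psnestAt σ k + #{j | j < k ∧ σ j = k} + #{j | σ j < k} =
      downCross σ k + downNest σ k + #{j | j = k} + #{j | j < k} := by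
    unfold psnestAt downCross downNest
    simp only [card_filter, ← sum_add_distrib]
    refine sum_congr rfl fun j _ => ?_
    rcases lt_trichotomy j k with h1 | rfl | h1
    · rcases lt_trichotomy (σ j) k with h2 | h2 | h2
      · simp [h1, h2, h1.not_gt, h1.ne, h2.ne, h2.not_gt]
      · simp [h1, h2, h1.not_gt, h1.ne]
      · simp [h1, h2, h1.not_gt, h1.ne, h2.ne', h2.not_gt]
    · simp [h]
    · rcases lt_trichotomy (σ j) (σ k) with h2 | h2 | h2
      · simp [h1, h2, h1.not_gt, h1.ne', h2.trans h, h2.not_gt]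
      · exact absurd (σ.injective h2) h1.ne'
      · simp [h1, h2, h1.not_gt, h1.ne', h2.not_gt]
  rw [card_filter_val_lt, card_filter_lt, ← e1, ← e2] at e3
  omega

lemma sum_card_between : ∑ i, #{k | i < k ∧ k < σ i} = ∑ k, psnestAt σ k := by
  unfold psnestAt
  simp only [card_filter]
  exact sum_comm

/-- The contribution of `i` to the inversion number, up to an even number. -/
def signCount (i : Fin n) : ℕ :=
  if σ i = i then 0 else if i < σ i then 1 + upCross σ i
    else if σ⁻¹ i < i then downCross σ i else 1 + downCross σ i

lemma sum_downNest_eq : ∃ N : Fin n → ℕ, ∑ i, downNest σ i = ∑ i, (signCount σ i + 2 * N i) := by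
  set N : Fin n → ℕ := fun i => if σ i = i then psnestAt σ i else if i < σ i then upNest σ i
    else downNest σ i with hN
  refine ⟨N, ?_⟩
  -- Not yet local: the last term is the number of indices under the upper arc of `i`. Summed over
  -- `i` it equals the sum of `psnestAt` by double counting, and the two cancel.
  have h : ∀ i, downNest σ i + psnestAt σ i =
      signCount σ i + 2 * N i + #{k | i < k ∧ k < σ i} := by
    intro i
    simp only [hN, signCount]
    rcases lt_trichotomy (σ i) i with hi | hi | hi
    · have h1 := psnestAt_of_gt σ hi
      have h2 : #{k | i < k ∧ k < σ i} = 0 := by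
        rw [card_eq_zero, filter_eq_empty_iff]
        exact fun k _ hk => lt_asymm hi (hk.1.trans hk.2)
      rw [if_neg hi.ne, if_neg hi.not_gt, if_neg hi.ne, if_neg hi.not_gt, h2]
      split_ifs at h1 ⊢ <;> omega
    · have h1 := downNest_add_val σ i
      have h2 : #{k | i < k ∧ k < σ i} = 0 := by
        rw [card_eq_zero, filter_eq_empty_iff]
        exact fun k _ hk => (hk.1.trans hk.2).ne' hi
      have h3 : upNest σ i = psnestAt σ i := by rw [upNest, psnestAt, hi]
      rw [hi] at h1
      rw [if_pos hi, if_pos hi, h2]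
      omega
    · have h1 := downNest_eq_of_lt σ hi
      have h2 := psnestAt_of_lt σ hi
      rw [if_neg hi.ne', if_pos hi, if_neg hi.ne', if_pos hi]
      omega
  have h' := sum_congr (rfl : (univ : Finset (Fin n)) = univ) fun i _ => h i
  rw [sum_add_distrib, sum_add_distrib, sum_card_between] at h'
  exact Nat.add_right_cancel h'

/-- `downNest σ i` counts the inversions whose left end is `i`. -/
lemma sign_eq_prod_downNest : (Equiv.Perm.sign σ : ℤ) = ∏ i, (-1) ^ downNest σ i := by
  rw [Equiv.Perm.sign_eq_prod_prod_Ioi, Units.coe_prod]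
  refine prod_congr rfl fun i _ => ?_
  have : downNest σ i = #{j ∈ Ioi i | ¬ σ i < σ j} := by
    unfold downNest
    congr 1
    ext j
    simp only [mem_filter, mem_univ, true_and, mem_Ioi, not_lt]
    refine and_congr_right fun h => ⟨le_of_lt, fun h' => lt_of_le_of_ne h' fun e => ?_⟩
    exact h.ne' (σ.injective e)
  rw [this, Units.coe_prod, ← prod_const, prod_filter]
  refine prod_congr rfl fun j _ => ?_
  split_ifs <;> simp_all

/-- Cycle lengths with fixed points add up to `n`, so `(-1)^cyc` is `(-1)^n` times the sign; the `+
1` in each exponent spreads `(-1)^n` over the indices. -/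
lemma neg_one_pow_cyc_int : (-1 : ℤ) ^ cyc σ = ∏ i, (-1) ^ (signCount σ i + 1) := by
  have h1 : (Equiv.Perm.sign σ : ℤ) = (-1) ^ (σ.cycleType.sum + σ.cycleType.card) := by
    rw [Equiv.Perm.sign_of_cycleType]; simp
  have h2 : σ.cycleType.sum + #(fixSet σ) = n := by
    have : fixSet σ = σ.supportᶜ := by ext i; simp [fixSet]
    rw [Equiv.Perm.sum_cycleType, this, card_add_card_compl, Fintype.card_fin]
  obtain ⟨N, hN⟩ := sum_downNest_eq σ
  have h3 : (Equiv.Perm.sign σ : ℤ) = ∏ i, (-1) ^ signCount σ i := by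
    rw [sign_eq_prod_downNest, prod_pow_eq_pow_sum, hN, ← prod_pow_eq_pow_sum]
    exact prod_congr rfl fun i _ => by rw [pow_add, pow_mul]; simp
  have h4 : ∏ i, (-1 : ℤ) ^ (signCount σ i + 1) = (-1) ^ n * Equiv.Perm.sign σ := by
    rw [h3]; simp only [pow_succ, prod_mul_distrib, prod_const, card_univ, Fintype.card_fin]
    ring
  rw [h4, h1, ← pow_add, cyc]
  have h5 : n + (σ.cycleType.sum + σ.cycleType.card) =
      σ.cycleType.card + #(fixSet σ) + 2 * σ.cycleType.sum := by omega
  rw [h5, pow_add _ _ (2 * _), pow_mul]; simp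

lemma neg_one_pow_cyc {R : Type*} [CommRing R] :
    (-1 : R) ^ cyc σ = ∏ i, (-1) ^ (signCount σ i + 1) := by
  have := congrArg (Int.cast : ℤ → R) (neg_one_pow_cyc_int σ)
  simpa using this

end LocalStatistics

end PermJ

namespace PermJ

/-! ### The summand as a product of local weights. -/

section Assembly

open Finset

variable {R : Type*} [CommRing R]

/-- The weight of an index with `c` crossings and `d` nestings: `x` or `u` according to whether it
is an exclusive (anti)record, times the signed crossing weight and the nesting weight. -/
def rankWeight (x u p q : R) (c d : ℕ) : R := (if d = 0 then x else u) * (-p) ^ c * q ^ d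

/-- Only the top rank has no nesting and receives `x`; every other term has a nesting, whence the
common factor `q * u`. -/
lemma rankSum_rankWeight (x u p q : R) (N : ℕ) :
    rankSum (rankWeight x u p q) (N + 1) = (-p) ^ N * x + q * pqInt (-p) q N * u := by
  rw [rankSum, sum_range_succ, add_comm]
  congr 1
  · simp [rankWeight, mul_comm]
  · rw [pqInt, mul_sum, sum_mul]
    refine sum_congr rfl fun r hr => ?_
    have hr' := mem_range.1 hr
    obtain ⟨d, hd⟩ : ∃ d, N = r + d + 1 := ⟨N - r - 1, by omega⟩
    have e1 : N + 1 - 1 - r = d + 1 := by omega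
    have e2 : N - 1 - r = d := by omega
    rw [e1, e2, rankWeight, if_neg (Nat.succ_ne_zero d)]
    ring

lemma pow_card_filter {ι : Type*} [Fintype ι] (x : R) (p : ι → Prop) [DecidablePred p] :
    x ^ #{i | p i} = ∏ i, if p i then x else 1 := by
  rw [← prod_filter, prod_const]

lemma pow_sum_filter {ι : Type*} [Fintype ι] (x : R) (p : ι → Prop) [DecidablePred p]
    (f : ι → ℕ) : x ^ (∑ i with p i, f i) = ∏ i, if p i then x ^ f i else 1 := by
  rw [← prod_filter, prod_pow_eq_pow_sum]

variable (x₁ x₂ y₁ y₂ u₁ u₂ v₁ v₂ : R) (w : ℕ → R) (pp1 pp2 pm1 pm2 qp1 qp2 qm1 qm2 s : R)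

/-- The weights of the four types of non-fixed indices. -/
def typeWeight : Bool × Bool → ℕ → ℕ → R
  | (true, false) => rankWeight y₁ v₁ pp1 qp1
  | (true, true) => rankWeight y₂ v₂ pp2 qp2
  -- At a peak `signCount` is just `downCross`, so the extra `+ 1` leaves a minus sign; at the other
  -- non-fixed types `signCount` has its own 1, which cancels it.
  | (false, true) => fun c d => -rankWeight x₁ u₁ pm1 qm1 c d
  | (false, false) => rankWeight x₂ u₂ pm2 qm2

lemma summand_eq_prod {n : ℕ} (σ : Equiv.Perm (Fin n)) :
    x₁ ^ eareccpeak σ * x₂ ^ eareccdfall σ * y₁ ^ ereccval σ * y₂ ^ ereccdrise σ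
    * (u₁ ^ nrcpeak σ * u₂ ^ nrcdfall σ * v₁ ^ nrcval σ * v₂ ^ nrcdrise σ
      * ∏ i ∈ fixSet σ, w (psnestAt σ i))
    * (pp1 ^ ucrosscval σ * pp2 ^ ucrosscdrise σ * pm1 ^ lcrosscpeak σ * pm2 ^ lcrosscdfall σ)
    * (qp1 ^ unestcval σ * qp2 ^ unestcdrise σ * qm1 ^ lnestcpeak σ * qm2 ^ lnestcdfall σ)
    * s ^ psnest σ * (-1) ^ cyc σ =
    ∏ i, indexWeight σ (typeWeight x₁ x₂ y₁ y₂ u₁ u₂ v₁ v₂ pp1 pp2 pm1 pm2 qp1 qp2 qm1 qm2)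
      (fun h => -(s ^ h * w h)) i := by
  simp only [neg_one_pow_cyc, ucrosscval_eq_sum, ucrosscdrise_eq_sum, lcrosscpeak_eq_sum,
    lcrosscdfall_eq_sum, unestcval_eq_sum, unestcdrise_eq_sum, lnestcpeak_eq_sum,
    lnestcdfall_eq_sum, psnest_eq_sum, eareccpeak, eareccdfall, ereccval, ereccdrise, nrcpeak,
    nrcdfall, nrcval, nrcdrise, pow_card_filter, pow_sum_filter, fixSet, prod_filter,
    ← prod_mul_distrib]
  refine prod_congr rfl fun i _ => ?_
  simp only [IsErec, IsEarec, IsNrar, isRec_iff, isArec_iff, IsCpeak, IsCval, IsCdrise, IsCdfall,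
    signCount, indexWeight, stepType]
  have hinv := inv_lt_iff_of_ne σ (i := i)
  rcases lt_trichotomy (σ i) i with hi | hi | hi
  · have hn := (upNest_pos σ hi).ne'
    rcases lt_or_ge (σ⁻¹ i) i with hj | hj
    · simp only [hi, hi.ne, hi.not_gt, hj, hj.not_gt, hn]
      by_cases hd : downNest σ i = 0 <;>
        simp [hd, typeWeight, rankWeight, neg_pow pm1, pow_succ] <;> ring
    · have hj' := (hinv hi.ne).1 hj.not_gt
      simp only [hi, hi.ne, hi.not_gt, hj', hj'.not_gt, hn]
      by_cases hd : downNest σ i = 0 <;>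
        simp [hd, typeWeight, rankWeight, neg_pow pm2, pow_succ, pow_add] <;> ring
  · have hj : σ⁻¹ i = i := (inv_eq_self_iff σ).2 hi
    simp only [hi, hj, lt_irrefl]
    simp [mul_comm]
  · have hn := (downNest_pos σ hi).ne'
    rcases lt_or_ge (σ⁻¹ i) i with hj | hj
    · simp only [hi, hi.ne', hi.not_gt, hj, hj.not_gt, hn]
      by_cases hd : upNest σ i = 0 <;>
        simp [hd, typeWeight, rankWeight, neg_pow pp2, pow_succ, pow_add] <;> ring
    · have hj' := (hinv hi.ne').1 hj.not_gt
      simp only [hi, hi.ne', hi.not_gt, hj', hj'.not_gt, hn]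
      by_cases hd : upNest σ i = 0 <;>
        simp [hd, typeWeight, rankWeight, neg_pow pp1, pow_succ, pow_add] <;> ring

end Assembly

end PermJ

theorem proposition4p2 {R : Type*} [CommRing R]
    (x₁ x₂ y₁ y₂ u₁ u₂ v₁ v₂ : R) (w : ℕ → R)
    (pp1 pp2 pm1 pm2 qp1 qp2 qm1 qm2 s : R) :
    PermJ.HasJFraction
      (PowerSeries.mk fun n =>
        PermJ.P n x₁ x₂ y₁ y₂ u₁ u₂ v₁ v₂ w pp1 pp2 pm1 pm2 qp1 qp2 qm1 qm2 s (-1))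
      -- the coefficients `γ_n`, `n ≥ 0`
      (fun n => if n = 0 then -w 0 else
        ((-pm2) ^ (n - 1) * x₂ + qm2 * PermJ.pqInt (-pm2) qm2 (n - 1) * u₂)
        + ((-pp2) ^ (n - 1) * y₂ + qp2 * PermJ.pqInt (-pp2) qp2 (n - 1) * v₂)
        - s ^ n * w n)
      -- the coefficients `β_n`, `n ≥ 1` (the value at `n = 0` is not used)
      (fun n =>
        -(((-pm1) ^ (n - 1) * x₁ + qm1 * PermJ.pqInt (-pm1) qm1 (n - 1) * u₁)
          * ((-pp1) ^ (n - 1) * y₁ + qp1 * PermJ.pqInt (-pp1) qp1 (n - 1) * v₁))) := by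
  set W := PermJ.typeWeight x₁ x₂ y₁ y₂ u₁ u₂ v₁ v₂ pp1 pp2 pm1 pm2 qp1 qp2 qm1 qm2 with hW
  have hP : ∀ n, PermJ.P n x₁ x₂ y₁ y₂ u₁ u₂ v₁ v₂ w pp1 pp2 pm1 pm2 qp1 qp2 qm1 qm2 s (-1) = _ :=
    fun n => (Finset.sum_congr rfl fun σ _ => PermJ.summand_eq_prod x₁ x₂ y₁ y₂ u₁ u₂ v₁ v₂ w
      pp1 pp2 pm1 pm2 qp1 qp2 qm1 qm2 s σ).trans (PermJ.sum_perm_eq_motzkin W _ n)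
  simp only [hP]
  convert PermJ.hasJFraction_motzkin _ _ _ _ ?_ using 1
  · funext n
    cases n with
    -- At height 0 both arc sums are empty and only the fixed-point term remains.
    | zero => simp [PermJ.rankSum]
    | succ n =>
      simp only [hW, PermJ.typeWeight, PermJ.rankSum_rankWeight, Nat.add_sub_cancel,
        if_neg (Nat.succ_ne_zero n)]
      ring
  · intro h
    -- A rise from `h` and a fall from `h + 1` each offer `h + 1` choices; the sign of `β` comes
    -- from the fall, that is, from the cycle peak.
    have hneg : PermJ.rankSum (W (false, true)) (h + 1) =
        -PermJ.rankSum (PermJ.rankWeight x₁ u₁ pm1 qm1) (h + 1) := by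
      simp [hW, PermJ.typeWeight, PermJ.rankSum]
    rw [hneg]
    simp only [hW, PermJ.typeWeight, PermJ.rankSum_rankWeight, Nat.add_sub_cancel]
    ring
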